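/- **Setting.** Let $l,d\ge 1$ and $N\ge 0$ be integers and let $\alpha>-d/2$. Put $\varkappa=\lfloor\alpha\rfloor+d+1$ and $q^{-1}=1+\alpha/d$. For $n\in\mathbb Z^d$ and $r>0$ let $\mathcal C^{(r)}_n=[-r/2,r/2)^d+n$ and $\mathcal C_n=\mathcal C_n^{(1)}$; write $s\wedge t=\min\{s,t\}$. For a compact operator $K$ between Hilbert spaces let $s_1(K)\ge s_2(K)\ge\dots$ be its singular values ($s_k(K)^2$ is the $k$-th largest positive eigenvalue of $K^*K$, counted with multiplicity, and $s_k(K)=0$ if there are fewer than $k$ of them). Let $\mathbf S_{q,\infty}$ be the class of compact $K$ with $\|K\|_{q,\infty}:=\sup_{k\ge1}k^{1/q}s_k(K)<\infty$. For a kernel $T$ on $\mathbb R^l\times\mathbb R^d$ and a function $a$ on $\mathbb R^d$, $\mathrm{Op}(T)a$ denotes the operator $L^2(\mathbb R^d)\to L^2(\mathbb R^l)$, $(\mathrm{Op}(T)a\,u)(t)=\int_{\mathbb R^d}T(t,x)a(x)u(x)\,dx$. **Theorem.** There is a constant $C$ depending only on $l,d,N,\alpha$ such that the following holds. Let $z_1,\dots,z_N:\mathbb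 R^l\to\mathbb R^d$ be arbitrary functions, $X(t)=\{z_1(t),\dots,z_N(t)\}$, let $A:\mathbb R^l\times\mathbb R^d\to[0,\infty)$, and let $T:\mathbb R^l\times\mathbb R^d\to\mathbb C$ be a measurable function such that for a.e. $t\in\mathbb R^l$ one has $T(t,\cdot)\in C^{\varkappa}(\mathbb R^d\setminus X(t))$ and $$|\partial_x^jT(t,x)|\le A(t,x)\Big(1+\sum_{k=1}^N\big(1\wedge|x-z_k(t)|\big)^{\alpha-|j|}\Big),\qquad x\notin X(t),\ |j|\le\varkappa .$$ If $d=1$ and $\alpha>0$, assume in addition that for a.e. $t$ the function $T(t,\cdot)$ coincides on $\mathbb R\setminus X(t)$ with a function in $C^{\lceil\alpha\rceil-1}(\mathbb R)$. Let $a\in L^\infty_{\rm loc}(\mathbb R^d)$, and suppose that for each $n\in\mathbb Z^d$ the function $A_n(t)=\|A(t,\cdot)\|_{L^\infty(\mathcal C_n^{(2\pi)})}$ belongs to $L^2(\mathbb R^l)$. If $$M:=\Big[\sum_{n\in\mathbb Z^d}\|A_n\|_{L^2(\mathbb R^l)}^q\,\|a\|_{L^\infty(\mathcal C_n)}^q\Big]^{1/q}<\infty,$$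 then $\mathrm{Op}(T)a$ is a well-defined bounded operator (for every $u\in L^2(\mathbb R^d)$ the integral converges absolutely for a.e. $t$), it belongs to $\mathbf S_{q,\infty}$, and $$\|\mathrm{Op}(T)a\|_{q,\infty}\le C\,M .$$ -/

import Mathlib

open MeasureTheory
open scoped ENNReal

noncomputable section

namespace KernelEstimate

section CompactOperators

variable {H G : Type*} [NormedAddCommGroup H] [InnerProductSpace ℂ H] [CompleteSpace H]
  [NormedAddCommGroup G] [InnerProductSpace ℂ G] [CompleteSpace G]

/-- The linear span of all eigenvectors of `B` with real eigenvalue at least `μ`. -/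
def spectralSpan (B : H →L[ℂ] H) (μ : ℝ) : Submodule ℂ H :=
  ⨆ (ν : ℝ) (_ : μ ≤ ν), Module.End.eigenspace (B : H →ₗ[ℂ] H) (ν : ℂ)

/-- For a compact operator `B = B* ≥ 0` and `k ≥ 1`: the `k`-th positive eigenvalue of `B`, in
descending order and counted with multiplicity, i.e. the largest `μ > 0` such that at least `k`
eigenvalues (with multiplicity) are `≥ μ`. It is `0` if `B` has fewer than `k` positive
eigenvalues. -/
def eigenvalueDesc (B : H →L[ℂ] H) (k : ℕ) : ℝ :=
  sSup {μ : ℝ | 0 < μ ∧ (k : Cardinal) ≤ Module.rank ℂ (spectralSpan B μ)}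

/-- The singular values `s_k(K)`, `k = 1, 2, …`, of a compact operator `K`, given by
`s_k(K)² = λ_k(K* K)`. -/
def singularValue (K : H →L[ℂ] G) (k : ℕ) : ℝ :=
  Real.sqrt (eigenvalueDesc (ContinuousLinearMap.adjoint K ∘L K) k)

/-- The quasi-norm `‖K‖_{p,∞} = sup_{k ≥ 1} s_k(K) k^{1/p}`, as an extended number. -/
def weakSchattenNorm (p : ℝ) (K : H →L[ℂ] G) : ℝ≥0∞ :=
  ⨆ (k : ℕ) (_ : 1 ≤ k), ENNReal.ofReal (singularValue K k * (k : ℝ) ^ (1 / p))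

/-- The class `S_{p,∞}` of compact operators. -/
def MemWeakSchatten (p : ℝ) (K : H →L[ℂ] G) : Prop :=
  IsCompactOperator K ∧ weakSchattenNorm p K < ∞

end CompactOperators

/-- `K : L²(Y) → L²(X)` is the integral operator with kernel `k(t, x)`: for every `u ∈ L²`, for
almost every `t` the integral `∫ k(t, x) u(x) dx` converges absolutely and equals `(K u)(t)`. -/
def IsIntegralOperator {X Y : Type*} [MeasureSpace X] [MeasureSpace Y] (k : X → Y → ℂ)
    (K : Lp ℂ 2 (volume : Measure Y) →L[ℂ] Lp ℂ 2 (volume : Measure X)) : Prop :=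
  ∀ u : Lp ℂ 2 (volume : Measure Y), ∀ᵐ t : X,
    Integrable (fun x => k t x * u x) ∧ K u t = ∫ x, k t x * u x

/-- The half-open cube `[-r/2, r/2)^d + n`. -/
def cube {d : ℕ} (r : ℝ) (n : Fin d → ℤ) : Set (EuclideanSpace ℝ (Fin d)) :=
  {x | ∀ i, (n i : ℝ) - r / 2 ≤ x i ∧ x i < (n i : ℝ) + r / 2}

/-- `a ∈ L^∞_loc(ℝ^d)`. -/
def MemLinftyLoc {d : ℕ} (a : EuclideanSpace ℝ (Fin d) → ℂ) : Prop :=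
  ∀ s : Set (EuclideanSpace ℝ (Fin d)), IsCompact s → MemLp a ∞ (volume.restrict s)

/-- The partial derivative `∂_{i 0} ∂_{i 1} ⋯ ∂_{i (m-1)} f` of order `m` at `x`. As `i` runs over
all sequences of length `m`, these are all the derivatives `∂^j f` with `|j| = m`. -/
def partialDeriv {d m : ℕ} (i : Fin m → Fin d) (f : EuclideanSpace ℝ (Fin d) → ℂ)
    (x : EuclideanSpace ℝ (Fin d)) : ℂ :=
  iteratedFDeriv ℝ m f x (fun r => EuclideanSpace.single (i r) (1 : ℝ))

/-- The order of smoothness `⌊α⌋ + d + 1` (a positive number when `α > -d`). -/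
def smoothnessOrder (α : ℝ) (d : ℕ) : ℕ := (⌊α⌋ + (d : ℤ) + 1).toNat

/-- `T` is a measurable kernel such that for almost every `t`, with `X(t) = {z_1(t), …, z_N(t)}` and
`ϰ = ⌊α⌋ + d + 1`, the function `T(t, ·)` is of class `C^ϰ` on `ℝ^d \ X(t)` and satisfies there
`|∂_x^j T(t, x)| ≤ A(t, x) (1 + ∑_k (1 ∧ |x - z_k(t)|)^{α - |j|})` for all `|j| ≤ ϰ`. -/
structure IsSingularKernel {l d N : ℕ} (α : ℝ)
    (z : Fin N → EuclideanSpace ℝ (Fin l) → EuclideanSpace ℝ (Fin d))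
    (A : EuclideanSpace ℝ (Fin l) → EuclideanSpace ℝ (Fin d) → ℝ)
    (T : EuclideanSpace ℝ (Fin l) → EuclideanSpace ℝ (Fin d) → ℂ) : Prop where
  aestronglyMeasurable : AEStronglyMeasurable (Function.uncurry T)
    ((volume : Measure (EuclideanSpace ℝ (Fin l))).prod
      (volume : Measure (EuclideanSpace ℝ (Fin d))))
  contDiffOn : ∀ᵐ t, ContDiffOn ℝ (smoothnessOrder α d) (T t) (Set.range (fun k => z k t))ᶜ
  bound : ∀ᵐ t, ∀ m : ℕ, m ≤ smoothnessOrder α d → ∀ i : Fin m → Fin d,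
    ∀ x ∉ Set.range (fun k => z k t),
      ‖partialDeriv i (T t) x‖ ≤ A t x * (1 + ∑ k, (min 1 ‖x - z k t‖) ^ (α - (m : ℝ)))

/-- The function `A_n(t) = ‖A(t, ·)‖_{L^∞([-π, π)^d + n)}`. -/
def localSup {l d : ℕ} (A : EuclideanSpace ℝ (Fin l) → EuclideanSpace ℝ (Fin d) → ℝ)
    (n : Fin d → ℤ) (t : EuclideanSpace ℝ (Fin l)) : ℝ≥0∞ :=
  eLpNorm (A t) ∞ (volume.restrict (cube (2 * Real.pi) n))

/-- The quantity `[∑_n ‖A_n‖_{L²}^q ‖a‖_{L^∞([-1/2, 1/2)^d + n)}^q]^{1/q}`. -/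
def latticeBound {l d : ℕ} (q : ℝ)
    (A : EuclideanSpace ℝ (Fin l) → EuclideanSpace ℝ (Fin d) → ℝ)
    (a : EuclideanSpace ℝ (Fin d) → ℂ) : ℝ≥0∞ :=
  (∑' n : Fin d → ℤ, eLpNorm (localSup A n) 2 volume ^ q *
    eLpNorm a ∞ (volume.restrict (cube 1 n)) ^ q) ^ (1 / q)

end KernelEstimate

end

/-!
The operator `Op(T)a` is compared with operators of finite rank, obtained by replacing `T(t, ·)`,
for each `t` separately, by a piecewise polynomial of degree less than `ϰ`.

Local error. Divide a unit cube into cubes of side `h`. On a small cube at distance at least `h`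
from the singular points the Taylor polynomial of order `ϰ` is used
(`exists_polynomial_of_far`). On a cube close to a singular point there are two cases. For `α ≤ 0`
the function itself is small enough in mean square (`norm_le_of_near_of_nonpos`). For `α > 0` the
Taylor polynomial of order `⌈α⌉` at a nearby regular point has an error `O(h ^ α)`, since the
remainder is the integral along a segment of derivatives of size `|x - z| ^ (α - ⌈α⌉)`, which is
integrable in one dimension (`exists_norm_sub_taylor_le`). In dimension `d ≥ 2` almost all segments
avoid the singular points; in dimension one they cannot be avoided, and this is where the extra
smoothness assumption enters. All cases give an error
`h ^ ϰ + ∑ₖ h ^ α φ(|x - zₖ| / h)` with a profile `φ ∈ L²(ℝ^d)` (`errorProfile`), because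
`2 α > -d` and `2 (α - ϰ) < -d`. Hence the square of the `L²` error on a unit cube is
`O(h ^ (2 α + d))`, uniformly in the positions of the singular points
(`exists_lintegral_error_sq_le`).

Global error. With `W n = ‖A_n‖ ‖a‖_{L^∞(C_n)}`, a budget of `κ` cells is distributed over the unit
cubes in proportion to `(W n) ^ q`. Since `(2 α + d) / d = 2 / q - 1`, the total squared error is
`O(κ ^ (1 - 2 / q) M ^ 2)` (`exists_mesh`). No summation theorem for operators in weak Schatten
classes is needed.

From approximation to singular values. Let `e_i` be orthonormal vectors orthogonal to the conjugates
of the basis functions of the approximating space. Bessel's inequality for fixed `t` gives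
`∑ ‖K e_i‖² ≤ ∫ dist(k(t, ·), span)² dt` (`sum_norm_sq_le_of_orthogonal`), where the approximants
need not depend measurably on `t`; the functions `z_k` are arbitrary. On the span of the eigenvectors
of `K* K` with eigenvalues at least `μ` one has `‖K x‖² ≥ μ ‖x‖²`, so a dimension count yields
`s_j² (j - r) ≤ O(κ ^ (1 - 2 / q) M ^ 2)` when `r = O(κ)` is the number of basis functions
(`singularValue_sq_mul_le`). The choice of `κ` as a small multiple of `j` gives the theorem, and
`κ → ∞` gives compactness.
-/

noncomputable section

namespace KernelEstimate

/-! ### Singular values and compactness from approximation on orthogonal complements -/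

section SingularValues

variable {H : Type*} [NormedAddCommGroup H] [InnerProductSpace ℂ H]

/-- The quadratic form of a symmetric operator is at least `μ` on its spectral subspace for
`[μ, ∞)`, because eigenspaces with distinct eigenvalues are orthogonal. -/
theorem mul_norm_sq_le_of_mem_spectralSpan {B : H →L[ℂ] H}
    (hB : (B : H →ₗ[ℂ] H).IsSymmetric) {μ : ℝ} {x : H} (hx : x ∈ spectralSpan B μ) :
    μ * ‖x‖ ^ 2 ≤ (inner ℂ x (B x)).re := by
  unfold spectralSpan at hx
  rw [iSup_subtype', Submodule.mem_iSup_iff_exists_finsupp] at hx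
  obtain ⟨f, hf, rfl⟩ := hx
  have hO : OrthogonalFamily ℂ
      (fun ν : {ν : ℝ // μ ≤ ν} => Module.End.eigenspace (B : H →ₗ[ℂ] H) ((ν : ℝ) : ℂ))
      fun ν => (Module.End.eigenspace (B : H →ₗ[ℂ] H) ((ν : ℝ) : ℂ)).subtypeₗᵢ :=
    hB.orthogonalFamily_eigenspaces.comp
      (f := fun ν : {ν : ℝ // μ ≤ ν} => ((ν : ℝ) : ℂ))
      (fun a b h => Subtype.ext (Complex.ofReal_injective h))
  have key := hO.inner_sum (fun ν => ⟨f ν, hf ν⟩) (fun ν => ((ν : ℝ) : ℂ) • ⟨f ν, hf ν⟩) f.support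
  have key2 := hO.inner_sum (fun ν => ⟨f ν, hf ν⟩) (fun ν => ⟨f ν, hf ν⟩) f.support
  simp only [Submodule.coe_subtypeₗᵢ, Submodule.subtype_apply, Submodule.coe_smul,
    Submodule.coe_inner] at key key2
  have hBx : B (f.sum fun _ x => x) = ∑ ν ∈ f.support, ((ν : ℝ) : ℂ) • f ν := by
    rw [Finsupp.sum, map_sum]
    exact Finset.sum_congr rfl fun ν _ => Module.End.mem_eigenspace_iff.1 (hf ν)
  have hn : ‖f.sum fun _ x => x‖ ^ 2 = ∑ ν ∈ f.support, ‖f ν‖ ^ 2 := by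
    rw [← inner_self_eq_norm_sq (𝕜 := ℂ), Finsupp.sum, key2, map_sum]
    exact Finset.sum_congr rfl fun ν _ => inner_self_eq_norm_sq (𝕜 := ℂ) _
  rw [hn, hBx, Finsupp.sum, key, Finset.mul_sum, Complex.re_sum]
  refine Finset.sum_le_sum fun ν _ => ?_
  rw [inner_smul_right, Complex.re_ofReal_mul]
  have h1 : (inner ℂ (f ν) (f ν)).re = ‖f ν‖ ^ 2 := inner_self_eq_norm_sq (𝕜 := ℂ) _
  rw [h1]
  exact mul_le_mul_of_nonneg_right ν.2 (sq_nonneg _)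

/-- A subspace of dimension at least `j` contains `j - r` orthonormal vectors orthogonal to `r`
given ones. -/
theorem exists_orthonormal_orthogonal {ι : Type*} [Fintype ι] (b : ι → H) (S : Submodule ℂ H)
    {j : ℕ} (hS : (j : Cardinal) ≤ Module.rank ℂ S) :
    ∃ (p : ℕ) (e : Fin p → H), j ≤ p + Fintype.card ι ∧ Orthonormal ℂ e ∧ (∀ i, e i ∈ S) ∧
      ∀ i k, inner ℂ (b k) (e i) = 0 := by
  obtain ⟨v, hv⟩ := Module.le_rank_iff.1 hS
  let S' : Submodule ℂ H := Submodule.span ℂ (Set.range fun i => (v i : H))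
  have hv' : LinearIndependent ℂ fun i => (v i : H) := hv.map' S.subtype (Submodule.ker_subtype S)
  have hS'S : S' ≤ S := Submodule.span_le.2 (by rintro _ ⟨i, rfl⟩; exact (v i).2)
  have hfin : Module.finrank ℂ S' = j := by
    have := finrank_span_eq_card hv'
    simpa using this
  have : FiniteDimensional ℂ S' := FiniteDimensional.span_of_finite ℂ (Set.finite_range _)
  let F : S' →ₗ[ℂ] (ι → ℂ) := LinearMap.pi fun k => (innerSL ℂ (b k)).toLinearMap ∘ₗ S'.subtype
  have hrank := F.finrank_range_add_finrank_ker
  have hle : Module.finrank ℂ (LinearMap.range F) ≤ Fintype.card ι := by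
    have := Submodule.finrank_le (LinearMap.range F)
    simpa using this
  let o := stdOrthonormalBasis ℂ (LinearMap.ker F)
  refine ⟨Module.finrank ℂ (LinearMap.ker F), fun i => ((o i : S') : H), by omega, ?_, ?_, ?_⟩
  · have h1 := o.orthonormal
    have h2 := h1.comp_linearIsometry (LinearMap.ker F).subtypeₗᵢ
    exact h2.comp_linearIsometry S'.subtypeₗᵢ
  · exact fun i => hS'S (o i : S').2
  · intro i k
    have := (o i).2
    rw [LinearMap.mem_ker] at this
    exact congrFun this k

variable {G : Type*} [NormedAddCommGroup G] [InnerProductSpace ℂ G] [CompleteSpace G]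

/-- An operator that is small on the orthogonal complement of suitable finite families is
compact. -/
theorem isCompactOperator_of_small_on_orthogonal {K : H →L[ℂ] G}
    (h : ∀ δ : ℝ, 0 < δ → ∃ (ι : Type) (_ : Fintype ι) (b : ι → H),
      ∀ e : H, ‖e‖ = 1 → (∀ k, inner ℂ (b k) e = 0) → ‖K e‖ ≤ δ) :
    IsCompactOperator K := by
  have hcl : IsClosed {f : H →L[ℂ] G | IsCompactOperator f} := isClosed_setOfPred_isCompactOperator
  refine hcl.closure_subset ?_
  rw [Metric.mem_closure_iff]
  intro δ hδ
  obtain ⟨ι, _, b, hb⟩ := h (δ / 2) (by positivity)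
  let W : Submodule ℂ H := Submodule.span ℂ (Set.range b)
  have : FiniteDimensional ℂ W := FiniteDimensional.span_of_finite ℂ (Set.finite_range _)
  refine ⟨K ∘L W.starProjection, ?_, ?_⟩
  · have : LocallyCompactSpace W := by
      have := FiniteDimensional.proper ℂ W
      infer_instance
    have h1 : IsCompactOperator (W.subtypeL : W →L[ℂ] H) :=
      (isCompactOperator_id_iff_locallyCompactSpace.2 this).clm_comp W.subtypeL
    have h2 : IsCompactOperator (W.subtypeL ∘L W.orthogonalProjectionOnto) :=
      h1.comp_clm W.orthogonalProjectionOnto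
    exact h2.clm_comp K
  · rw [dist_eq_norm]
    refine lt_of_le_of_lt (ContinuousLinearMap.opNorm_le_bound _ (by positivity) fun x => ?_)
      (half_lt_self hδ)
    have hx : (K - K ∘L W.starProjection) x = K (x - W.starProjection x) := by simp
    rw [hx]
    set y := x - W.starProjection x with hy
    have hyW : y ∈ Wᗮ := Submodule.sub_starProjection_mem_orthogonal x
    have hyx : ‖y‖ ≤ ‖x‖ := by
      have := Submodule.norm_sq_eq_add_norm_sq_starProjection x W
      rw [Submodule.starProjection_orthogonal_val] at this
      rw [← hy] at this
      exact le_of_sq_le_sq (by nlinarith [sq_nonneg ‖W.starProjection x‖]) (norm_nonneg _)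
    rcases eq_or_ne y 0 with h0 | h0
    · rw [h0]; simp; positivity
    · have hn : (0 : ℝ) < ‖y‖ := norm_pos_iff.2 h0
      have h1 := hb (((‖y‖⁻¹ : ℝ) : ℂ) • y) (by
        rw [norm_smul, Complex.norm_real, norm_inv, norm_norm, inv_mul_cancel₀ hn.ne'])
        (fun k => by
          rw [inner_smul_right, hyW (b k) (Submodule.subset_span ⟨k, rfl⟩), mul_zero])
      rw [map_smul, norm_smul, Complex.norm_real, norm_inv, norm_norm, inv_mul_le_iff₀ hn] at h1
      nlinarith

variable [CompleteSpace H]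

/-- Bound on a singular value in terms of the Hilbert–Schmidt norm of the operator on the
orthogonal complement of finitely many vectors. -/
theorem singularValue_sq_mul_le {K : H →L[ℂ] G} {ι : Type*} [Fintype ι] (b : ι → H) {δ : ℝ}
    (h : ∀ (p : ℕ) (e : Fin p → H), Orthonormal ℂ e → (∀ i k, inner ℂ (b k) (e i) = 0) →
      ∑ i, ‖K (e i)‖ ^ 2 ≤ δ) {j : ℕ} (hj : Fintype.card ι < j) :
    singularValue K j ^ 2 * ((j : ℝ) - Fintype.card ι) ≤ δ := by
  have hδ : 0 ≤ δ := by
    have := h 0 (fun i => i.elim0) ⟨fun i => i.elim0, fun i => i.elim0⟩ fun i => i.elim0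
    simpa using this
  have hpos : (0 : ℝ) < (j : ℝ) - Fintype.card ι := by
    rw [sub_pos]; exact_mod_cast hj
  have hev : eigenvalueDesc (ContinuousLinearMap.adjoint K ∘L K) j ≤
      δ / ((j : ℝ) - Fintype.card ι) := by
    refine Real.sSup_le ?_ (div_nonneg hδ hpos.le)
    rintro μ ⟨hμ, hrank⟩
    obtain ⟨p, e, hp, he, heS, heb⟩ := exists_orthonormal_orthogonal b _ hrank
    have hsym : ((ContinuousLinearMap.adjoint K ∘L K : H →L[ℂ] H) : H →ₗ[ℂ] H).IsSymmetric := by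
      intro x y
      simp [ContinuousLinearMap.adjoint_inner_left, ContinuousLinearMap.adjoint_inner_right]
    have hlow : ∀ i, μ ≤ ‖K (e i)‖ ^ 2 := by
      intro i
      have h1 := mul_norm_sq_le_of_mem_spectralSpan hsym (heS i)
      rw [he.1 i] at h1
      simp only [ContinuousLinearMap.comp_apply, ContinuousLinearMap.adjoint_inner_right,
        inner_self_eq_norm_sq_to_K] at h1
      have h2 : (((‖K (e i)‖ : ℝ) : ℂ) ^ 2).re = ‖K (e i)‖ ^ 2 := by
        rw [← Complex.ofReal_pow, Complex.ofReal_re]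
      simp only [Complex.coe_algebraMap] at h1
      rw [h2] at h1
      linarith
    have h3 : (p : ℝ) * μ ≤ δ := by
      refine le_trans ?_ (h p e he heb)
      have := Finset.sum_le_sum fun (i : Fin p) (_ : i ∈ Finset.univ) => hlow i
      simpa using this
    rw [le_div_iff₀ hpos]
    have h4 : (j : ℝ) ≤ p + Fintype.card ι := by exact_mod_cast hp
    nlinarith
  have h0 : singularValue K j ^ 2 ≤ δ / ((j : ℝ) - Fintype.card ι) := by
    unfold singularValue
    rw [Real.sq_sqrt']
    exact max_le hev (div_nonneg hδ hpos.le)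
  rwa [le_div_iff₀ hpos] at h0

end SingularValues

/-! ### Integral operators with square integrable kernels -/

section IntegralOperators

theorem eLpNorm_two_sq {Y E : Type*} [MeasurableSpace Y] [ENorm E] (μ : Measure Y)
    (f : Y → E) : eLpNorm f 2 μ ^ 2 = ∫⁻ x, ‖f x‖ₑ ^ 2 ∂μ := by
  have := eLpNorm_nnreal_pow_eq_lintegral (μ := μ) (f := f) (p := 2) (by norm_num)
  simpa using this

theorem memLp_two_of_lintegral_lt_top {Y E : Type*} [MeasurableSpace Y] [NormedAddCommGroup E]
    {μ : Measure Y} {f : Y → E} (hf : AEStronglyMeasurable f μ)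
    (h : ∫⁻ x, ‖f x‖ₑ ^ 2 ∂μ < ∞) : MemLp f 2 μ := by
  refine ⟨hf, ?_⟩
  rw [← eLpNorm_two_sq] at h
  exact (ENNReal.pow_lt_top_iff.1 h).resolve_right (by norm_num)

variable {X Y : Type*} [MeasureSpace X] [MeasureSpace Y]

theorem memLp_conj {f : Y → ℂ} (hf : MemLp f 2) : MemLp (fun x => starRingEnd ℂ (f x)) 2 :=
  hf.star

/-- The bilinear pairing with `f ∈ L²` as an inner product with the conjugate of `f`. -/
theorem inner_toLp_conj {f : Y → ℂ} (hf : MemLp f 2) (u : Lp ℂ 2 (volume : Measure Y)) :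
    inner ℂ ((memLp_conj hf).toLp _) u = ∫ x, f x * u x := by
  rw [L2.inner_def]
  refine integral_congr_ae ?_
  filter_upwards [(memLp_conj hf).coeFn_toLp] with x hx
  rw [hx, RCLike.inner_apply, RingHomCompTriple.comp_apply, RingHom.id_apply, mul_comm]

theorem enorm_toLp_conj_sq {f : Y → ℂ} (hf : MemLp f 2) :
    ‖(memLp_conj hf).toLp _‖ₑ ^ 2 = ∫⁻ x, ‖f x‖ₑ ^ 2 := by
  rw [Lp.enorm_toLp, eLpNorm_two_sq]
  simp

theorem enorm_integral_mul_sq_le {f : Y → ℂ} (hf : MemLp f 2) (u : Lp ℂ 2 (volume : Measure Y)) :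
    ‖∫ x, f x * u x‖ₑ ^ 2 ≤ (∫⁻ x, ‖f x‖ₑ ^ 2) * ‖u‖ₑ ^ 2 := by
  rw [← inner_toLp_conj hf, ← enorm_toLp_conj_sq hf, ← mul_pow]
  gcongr
  rw [← ofReal_norm, ← ofReal_norm, ← ofReal_norm, ← ENNReal.ofReal_mul (norm_nonneg _)]
  exact ENNReal.ofReal_le_ofReal (norm_inner_le_norm _ _)

/-- Bessel's inequality for the bilinear pairing. -/
theorem sum_enorm_integral_mul_sq_le {f : Y → ℂ} (hf : MemLp f 2) {p : ℕ}
    {e : Fin p → Lp ℂ 2 (volume : Measure Y)} (he : Orthonormal ℂ e) :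
    ∑ i, ‖∫ x, f x * e i x‖ₑ ^ 2 ≤ ∫⁻ x, ‖f x‖ₑ ^ 2 := by
  rw [← enorm_toLp_conj_sq hf]
  have h := he.sum_inner_products_le ((memLp_conj hf).toLp _) (s := Finset.univ)
  simp_rw [← inner_toLp_conj hf, ← ofReal_norm, ← ENNReal.ofReal_pow (norm_nonneg _)]
  rw [← ENNReal.ofReal_sum_of_nonneg fun i _ => sq_nonneg _]
  refine ENNReal.ofReal_le_ofReal ?_
  simpa only [norm_inner_symm] using h

/-- Orthogonality to the conjugates of `φ i` lets one subtract from the kernel, separately for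
every `t`, a linear combination of the `φ i`. Therefore the Hilbert–Schmidt norm on the orthogonal
complement is controlled by the distance of `k(t, ·)` from the span of the `φ i`; no measurability
of the coefficients in `t` is involved. -/
theorem sum_norm_sq_le_of_orthogonal {k : X → Y → ℂ}
    {K : Lp ℂ 2 (volume : Measure Y) →L[ℂ] Lp ℂ 2 (volume : Measure X)}
    (hK : IsIntegralOperator k K) (hk : ∀ᵐ t, MemLp (k t) 2)
    {ι : Type*} [Fintype ι] {φ : ι → Y → ℂ} (hφ : ∀ i, MemLp (φ i) 2) {ε : X → ℝ≥0∞}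
    (hε : ∫⁻ t, ε t ≠ ∞)
    (happ : ∀ᵐ t, ∃ c : ι → ℂ, ∫⁻ x, ‖k t x - ∑ i, c i * φ i x‖ₑ ^ 2 ≤ ε t)
    {p : ℕ} {e : Fin p → Lp ℂ 2 (volume : Measure Y)} (he : Orthonormal ℂ e)
    (horth : ∀ i j, inner ℂ ((memLp_conj (hφ j)).toLp _) (e i) = 0) :
    ∑ i, ‖K (e i)‖ ^ 2 ≤ (∫⁻ t, ε t).toReal := by
  have h1 : ∀ i, ‖K (e i)‖ₑ ^ 2 = ∫⁻ t, ‖K (e i) t‖ₑ ^ 2 := by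
    intro i
    rw [Lp.enorm_def, eLpNorm_two_sq]
  have h2 : ∑ i, ‖K (e i)‖ₑ ^ 2 ≤ ∫⁻ t, ε t := by
    simp_rw [h1]
    rw [← lintegral_finsetSum' _ fun i _ =>
      ((Lp.aestronglyMeasurable (K (e i))).enorm.pow_const 2)]
    refine lintegral_mono_ae ?_
    filter_upwards [hk, happ, ae_all_iff.2 fun i => hK (e i)] with t ht ⟨c, hc⟩ hKt
    have hsum : MemLp (fun x => ∑ j, c j * φ j x) 2 :=
      memLp_finsetSum _ fun j _ => (hφ j).const_mul (c j)
    refine le_trans (le_of_eq ?_) ((sum_enorm_integral_mul_sq_le (ht.sub hsum) he).trans hc)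
    refine Finset.sum_congr rfl fun i _ => ?_
    rw [(hKt i).2]
    congr 2
    have hint : ∀ j, Integrable fun x => φ j x * e i x := fun j =>
      (hφ j).integrable_mul (Lp.memLp (e i))
    have h0 : ∫ x, (∑ j, c j * φ j x) * e i x = 0 := by
      simp_rw [Finset.sum_mul, mul_assoc]
      rw [integral_finsetSum _ fun j _ => (hint j).const_mul (c j)]
      refine Finset.sum_eq_zero fun j _ => ?_
      rw [integral_const_mul, ← inner_toLp_conj (hφ j), horth i j, mul_zero]
    have hs : Integrable fun x => (∑ j, c j * φ j x) * e i x :=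
      hsum.integrable_mul (Lp.memLp (e i))
    simp only [Pi.sub_apply, sub_mul]
    rw [integral_sub (hKt i).1 hs, h0, sub_zero]
  rw [← ENNReal.ofReal_le_iff_le_toReal hε, ENNReal.ofReal_sum_of_nonneg fun i _ => sq_nonneg _]
  simpa only [ENNReal.ofReal_pow (norm_nonneg _), ofReal_norm] using h2

/-- A kernel in `L²(X × Y)` defines a bounded integral operator `L²(Y) → L²(X)`. -/
theorem exists_isIntegralOperator [SFinite (volume : Measure X)] [SFinite (volume : Measure Y)]
    {k : X → Y → ℂ}
    (hm : AEStronglyMeasurable (Function.uncurry k)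
      ((volume : Measure X).prod (volume : Measure Y)))
    (hk : ∀ᵐ t, MemLp (k t) 2) (hfin : ∫⁻ t, ∫⁻ x, ‖k t x‖ₑ ^ 2 ≠ ∞) :
    ∃ K : Lp ℂ 2 (volume : Measure Y) →L[ℂ] Lp ℂ 2 (volume : Measure X),
      IsIntegralOperator k K := by
  have hmeas : ∀ u : Lp ℂ 2 (volume : Measure Y),
      AEStronglyMeasurable (fun t => ∫ x, k t x * u x) (volume : Measure X) := by
    intro u
    have hu : AEStronglyMeasurable (fun p : X × Y => u p.2)
        ((volume : Measure X).prod (volume : Measure Y)) :=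
      (Lp.aestronglyMeasurable u).comp_snd
    exact (hm.mul hu).integral_prod_right'
  have hbound : ∀ u : Lp ℂ 2 (volume : Measure Y),
      ∫⁻ t, ‖∫ x, k t x * u x‖ₑ ^ 2 ≤ (∫⁻ t, ∫⁻ x, ‖k t x‖ₑ ^ 2) * ‖u‖ₑ ^ 2 := by
    intro u
    rw [← lintegral_mul_const' _ _ (by finiteness)]
    refine lintegral_mono_ae ?_
    filter_upwards [hk] with t ht using enorm_integral_mul_sq_le ht u
  have hmem : ∀ u : Lp ℂ 2 (volume : Measure Y),
      MemLp (fun t => ∫ x, k t x * u x) 2 (volume : Measure X) := fun u =>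
    memLp_two_of_lintegral_lt_top (hmeas u)
      ((hbound u).trans_lt (ENNReal.mul_lt_top hfin.lt_top (by finiteness)))
  have hint : ∀ u : Lp ℂ 2 (volume : Measure Y), ∀ᵐ t, Integrable fun x => k t x * u x := by
    intro u
    filter_upwards [hk] with t ht using ht.integrable_mul (Lp.memLp u)
  let K₀ : Lp ℂ 2 (volume : Measure Y) →ₗ[ℂ] Lp ℂ 2 (volume : Measure X) :=
    { toFun := fun u => (hmem u).toLp _
      map_add' := by
        intro u v
        rw [← MemLp.toLp_add, MemLp.toLp_eq_toLp_iff]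
        filter_upwards [hint u, hint v] with t hu hv
        rw [Pi.add_apply, ← integral_add hu hv]
        refine integral_congr_ae ?_
        filter_upwards [Lp.coeFn_add u v] with x hx
        rw [hx, Pi.add_apply, mul_add]
      map_smul' := by
        intro c u
        rw [RingHom.id_apply, ← MemLp.toLp_const_smul, MemLp.toLp_eq_toLp_iff]
        filter_upwards with t
        rw [Pi.smul_apply, smul_eq_mul, ← integral_const_mul]
        refine integral_congr_ae ?_
        filter_upwards [Lp.coeFn_smul c u] with x hx
        rw [hx, Pi.smul_apply, smul_eq_mul]
        ring }
  refine ⟨K₀.mkContinuous (Real.sqrt (∫⁻ t, ∫⁻ x, ‖k t x‖ₑ ^ 2).toReal) fun u => ?_, fun u => ?_⟩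
  · have h1 : ‖K₀ u‖ₑ ^ 2 ≤ (∫⁻ t, ∫⁻ x, ‖k t x‖ₑ ^ 2) * ‖u‖ₑ ^ 2 := by
      refine le_trans (le_of_eq ?_) (hbound u)
      change ‖(hmem u).toLp _‖ₑ ^ 2 = _
      rw [Lp.enorm_toLp, eLpNorm_two_sq]
    have h2 := ENNReal.toReal_mono (ENNReal.mul_ne_top hfin (by finiteness)) h1
    simp only [ENNReal.toReal_mul, ENNReal.toReal_pow, toReal_enorm] at h2
    refine le_of_sq_le_sq ?_ (by positivity)
    rwa [mul_pow, Real.sq_sqrt ENNReal.toReal_nonneg]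
  · filter_upwards [hint u, (hmem u).coeFn_toLp] with t h1 h2
    exact ⟨h1, h2⟩

end IntegralOperators

/-! ### Taylor's formula with a singular derivative of the highest order, and Taylor polynomials -/

section Taylor

open Set intervalIntegral

/-- Taylor's formula for a function with a chain `H 0, H 1, …, H n` of successive derivatives, the
last of which oscillates by at most `I`. -/
theorem norm_sub_taylor_sum_le {I : ℝ} (n : ℕ) :
    ∀ H : ℕ → ℝ → ℂ,
      (∀ j < n, ∀ s ∈ Icc (0 : ℝ) 1, HasDerivWithinAt (H j) (H (j + 1) s) (Icc 0 1) s) →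
      (∀ s ∈ Icc (0 : ℝ) 1, ‖H n s - H n 0‖ ≤ I) →
      ∀ s ∈ Icc (0 : ℝ) 1,
        ‖H 0 s - ∑ j ∈ Finset.range (n + 1), ((s ^ j / j.factorial : ℝ) : ℂ) * H j 0‖ ≤ I := by
  induction n with
  | zero =>
    intro H _ hI s hs
    simpa using hI s hs
  | succ n ih =>
    intro H hH hI s hs
    have hI0 : 0 ≤ I := (norm_nonneg _).trans (hI s hs)
    have ih' := ih (fun j => H (j + 1)) (fun j hj => hH (j + 1) (by omega)) hI
    have hder : ∀ r ∈ Icc (0 : ℝ) 1, HasDerivWithinAt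
        (fun r => H 0 r - ∑ j ∈ Finset.range (n + 1 + 1), ((r ^ j / j.factorial : ℝ) : ℂ) * H j 0)
        (H 1 r - ∑ j ∈ Finset.range (n + 1), ((r ^ j / j.factorial : ℝ) : ℂ) * H (j + 1) 0)
        (Icc 0 1) r := by
      intro r hr
      refine (hH 0 (by omega) r hr).sub ?_
      have h1 : ∀ r : ℝ,
          ∑ j ∈ Finset.range (n + 1 + 1), ((r ^ j / j.factorial : ℝ) : ℂ) * H j 0 =
          ∑ j ∈ Finset.range (n + 1),
            ((r ^ (j + 1) / (j + 1).factorial : ℝ) : ℂ) * H (j + 1) 0 + H 0 0 := by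
        intro r
        rw [Finset.sum_range_succ']
        simp
      simp_rw [h1]
      refine HasDerivWithinAt.add_const _ (HasDerivWithinAt.fun_sum fun j _ => ?_)
      refine HasDerivWithinAt.mul_const ?_ _
      refine HasDerivAt.hasDerivWithinAt (HasDerivAt.ofReal_comp ?_)
      have h2 := (hasDerivAt_pow (j + 1) r).div_const ((j + 1).factorial : ℝ)
      convert! h2 using 1
      rw [Nat.factorial_succ]
      push_cast
      have : (j.factorial : ℝ) ≠ 0 := by positivity
      field_simp
    have h := (convex_Icc (0 : ℝ) 1).norm_image_sub_le_of_norm_hasDerivWithin_le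
      (x := 0) (y := s) hder ih' (by simp) hs
    have h0 : H 0 0 - ∑ j ∈ Finset.range (n + 1 + 1),
        (((0 : ℝ) ^ j / j.factorial : ℝ) : ℂ) * H j 0 = 0 := by
      rw [Finset.sum_range_succ']
      simp
    simp only [h0, sub_zero] at h
    refine h.trans ?_
    rw [Real.norm_of_nonneg hs.1]
    nlinarith [hs.2]

variable {E : Type*} [NormedAddCommGroup E] [NormedSpace ℝ E]

theorem hasDerivAt_iteratedFDeriv_line {f : E → ℂ} {j : ℕ} {y v : E} {s : ℝ}
    (hf : ContDiffAt ℝ (j + 1 : ℕ) f (y + s • v)) :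
    HasDerivAt (fun r : ℝ => iteratedFDeriv ℝ j f (y + r • v) fun _ => v)
      (iteratedFDeriv ℝ (j + 1) f (y + s • v) fun _ => v) s := by
  have h1 := (hf.differentiableAt_iteratedFDeriv (m := j) (by exact_mod_cast j.lt_succ_self)
    ).hasFDerivAt
  have h2 : HasDerivAt (fun r : ℝ => y + r • v) v s := by
    simpa using ((hasDerivAt_id s).smul_const v).const_add y
  have h3 := h1.comp_hasDerivAt s h2
  have h4 := (ContinuousMultilinearMap.apply ℝ (fun _ : Fin j => E) ℂ fun _ => v
    ).hasFDerivAt.comp_hasDerivAt s h3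
  rw [iteratedFDeriv_succ_apply_left]
  exact h4

/-- Taylor's formula of order `n + 1` along the segment from `y` to `y + v`, for a function that is
`C ^ n` near the segment and `C ^ (n + 1)` near all but countably many of its points, with an
integrable bound on the derivative of order `n + 1`. -/
theorem norm_sub_taylor_le_integral {f : E → ℂ} {n : ℕ} {y v : E} {F : Set ℝ} (hF : F.Countable)
    {g : ℝ → ℝ} (hg : IntervalIntegrable g volume 0 1)
    (hf : ∀ s ∈ Icc (0 : ℝ) 1, ContDiffAt ℝ n f (y + s • v))
    (hf' : ∀ s ∈ Icc (0 : ℝ) 1 \ F, ContDiffAt ℝ (n + 1 : ℕ) f (y + s • v) ∧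
      ‖iteratedFDeriv ℝ (n + 1) f (y + s • v) fun _ => v‖ ≤ g s) :
    ‖f (y + v) - ∑ j ∈ Finset.range (n + 1),
        ((1 / j.factorial : ℝ) : ℂ) * iteratedFDeriv ℝ j f y fun _ => v‖
      ≤ ∫ s in (0 : ℝ)..1, g s := by
  let H : ℕ → ℝ → ℂ := fun j s => iteratedFDeriv ℝ j f (y + s • v) fun _ => v
  have hFnull : ∀ᵐ s : ℝ, s ∉ F := hF.ae_notMem volume
  have hdif : ∀ s ∈ Icc (0 : ℝ) 1 \ F, HasDerivAt (H n) (H (n + 1) s) s := fun s hs =>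
    hasDerivAt_iteratedFDeriv_line (hf' s hs).1
  have hcont : ContinuousOn (H n) (Icc 0 1) := by
    intro s hs
    have h1 := (hf s hs).continuousAt_iteratedFDeriv (k := n) le_rfl
    have h2 : ContinuousAt (fun r : ℝ => y + r • v) s := by fun_prop
    have h3 : ContinuousAt (fun r : ℝ => iteratedFDeriv ℝ n f (y + r • v)) s :=
      ContinuousAt.comp (f := fun r : ℝ => y + r • v) h1 h2
    exact ((ContinuousMultilinearMap.apply ℝ (fun _ : Fin n => E) ℂ fun _ => v
      ).continuous.continuousAt.comp h3).continuousWithinAt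
  have hnn : ∀ᵐ s ∂volume.restrict (Ioc (0 : ℝ) 1), ‖deriv (H n) s‖ ≤ g s := by
    filter_upwards [ae_restrict_mem measurableSet_Ioc, ae_restrict_of_ae hFnull] with s hs hsF
    have hs' : s ∈ Icc (0 : ℝ) 1 \ F := ⟨Ioc_subset_Icc_self hs, hsF⟩
    rw [(hdif s hs').deriv]
    exact (hf' s hs').2
  have hint : IntegrableOn (deriv (H n)) (Ioc 0 1) :=
    Integrable.mono' ((intervalIntegrable_iff_integrableOn_Ioc_of_le zero_le_one).1 hg)
      (measurable_deriv (H n)).aestronglyMeasurable hnn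
  have hosc : ∀ s ∈ Icc (0 : ℝ) 1, ‖H n s - H n 0‖ ≤ ∫ s in (0 : ℝ)..1, g s := by
    intro s hs
    have hsub : Ioc 0 s ⊆ Ioc 0 1 := Ioc_subset_Ioc_right hs.2
    have hFTC := integral_eq_of_hasDerivAt_off_countable_of_le (H n) (deriv (H n)) hs.1 hF
      (hcont.mono (Icc_subset_Icc_right hs.2))
      (fun r hr => by
        have h := hdif r ⟨⟨hr.1.1.le, hr.1.2.le.trans hs.2⟩, hr.2⟩
        rwa [h.deriv])
      ((intervalIntegrable_iff_integrableOn_Ioc_of_le hs.1).2 (hint.mono_set hsub))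
    rw [← hFTC, integral_of_le hs.1, integral_of_le zero_le_one]
    calc ‖∫ r in Ioc 0 s, deriv (H n) r‖ ≤ ∫ r in Ioc 0 s, ‖deriv (H n) r‖ :=
          norm_integral_le_integral_norm _
      _ ≤ ∫ r in Ioc 0 1, ‖deriv (H n) r‖ :=
          setIntegral_mono_set hint.norm (ae_of_all _ fun _ => norm_nonneg _)
            hsub.eventuallyLE
      _ ≤ ∫ r in Ioc 0 1, g r := integral_mono_ae hint.norm
          ((intervalIntegrable_iff_integrableOn_Ioc_of_le zero_le_one).1 hg) hnn
  have h := norm_sub_taylor_sum_le n H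
    (fun j hj s hs => (hasDerivAt_iteratedFDeriv_line
      ((hf s hs).of_le (by exact_mod_cast hj))).hasDerivWithinAt) hosc 1 (by simp)
  simpa [H] using h

end Taylor

section Polynomials

variable {d : ℕ}

/-- The derivative of order `m` on the diagonal in terms of partial derivatives. -/
theorem iteratedFDeriv_diag_eq_sum (f : EuclideanSpace ℝ (Fin d) → ℂ) (m : ℕ)
    (x v : EuclideanSpace ℝ (Fin d)) :
    (iteratedFDeriv ℝ m f x fun _ => v) =
      ∑ r : Fin m → Fin d, ((∏ i, v (r i) : ℝ) : ℂ) * partialDeriv r f x := by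
  have hv : v = ∑ i, v i • EuclideanSpace.single i (1 : ℝ) := by
    have := (EuclideanSpace.basisFun (Fin d) ℝ).sum_repr v
    simpa using this.symm
  conv_lhs => rw [hv]
  rw [ContinuousMultilinearMap.map_sum]
  refine Finset.sum_congr rfl fun r _ => ?_
  rw [ContinuousMultilinearMap.map_smul_univ, Complex.real_smul]
  rfl

theorem norm_iteratedFDeriv_diag_le {f : EuclideanSpace ℝ (Fin d) → ℂ} {m : ℕ}
    {x v : EuclideanSpace ℝ (Fin d)} {b : ℝ}
    (hb : ∀ r : Fin m → Fin d, ‖partialDeriv r f x‖ ≤ b) :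
    ‖iteratedFDeriv ℝ m f x fun _ => v‖ ≤ (d : ℝ) ^ m * (‖v‖ ^ m * b) := by
  rw [iteratedFDeriv_diag_eq_sum]
  refine (norm_sum_le _ _).trans ?_
  have : ∀ r ∈ (Finset.univ : Finset (Fin m → Fin d)),
      ‖((∏ i, v (r i) : ℝ) : ℂ) * partialDeriv r f x‖ ≤ ‖v‖ ^ m * b := by
    intro r _
    rw [norm_mul, Complex.norm_real, norm_prod]
    refine mul_le_mul ?_ (hb r) (norm_nonneg _) (by positivity)
    refine (Finset.prod_le_prod (fun _ _ => norm_nonneg _) fun i _ =>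
      PiLp.norm_apply_le v (r i)).trans ?_
    simp
  refine (Finset.sum_le_card_nsmul _ _ _ this).trans (le_of_eq ?_)
  simp

/-- `P` is a linear combination of the monomials `x ^ β` with all exponents less than `ϰ`. -/
def IsPolynomialLT (ϰ : ℕ) (P : EuclideanSpace ℝ (Fin d) → ℂ) : Prop :=
  ∃ c : (Fin d → Fin ϰ) → ℂ, ∀ x, P x = ∑ β, c β * ∏ i, (x i : ℂ) ^ (β i : ℕ)

theorem IsPolynomialLT.zero (ϰ : ℕ) :
    IsPolynomialLT ϰ (fun _ : EuclideanSpace ℝ (Fin d) => (0 : ℂ)) :=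
  ⟨0, fun x => by simp⟩

theorem isPolynomialLT_eval {ϰ : ℕ} (p : MvPolynomial (Fin d) ℂ) (hp : p.totalDegree < ϰ) :
    IsPolynomialLT ϰ fun x : EuclideanSpace ℝ (Fin d) =>
      MvPolynomial.eval (fun i => (x i : ℂ)) p := by
  classical
  let φ : (Fin d → Fin ϰ) → (Fin d →₀ ℕ) :=
    fun β => Finsupp.equivFunOnFinite.symm fun i => (β i : ℕ)
  have hφ : Function.Injective φ := fun β γ h => by
    funext i
    exact Fin.ext (congrFun (Finsupp.equivFunOnFinite.symm.injective h) i)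
  refine ⟨fun β => p.coeff (φ β), fun x => ?_⟩
  have hsub : p.support ⊆ Finset.univ.image φ := by
    intro s hs
    have hlt : ∀ i, s i < ϰ := fun i =>
      (MvPolynomial.monomial_le_degreeOf i hs).trans_lt
        ((MvPolynomial.degreeOf_le_totalDegree p i).trans_lt hp)
    exact Finset.mem_image.2 ⟨fun i => ⟨s i, hlt i⟩, Finset.mem_univ _, by ext i; rfl⟩
  beta_reduce
  rw [MvPolynomial.eval_eq', Finset.sum_subset hsub fun s _ hs => by
    rw [MvPolynomial.notMem_support_iff.1 hs, zero_mul], Finset.sum_image hφ.injOn]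
  rfl

/-- Taylor polynomials of order less than `ϰ` are combinations of the monomials allowed in
`IsPolynomialLT`. -/
theorem isPolynomialLT_taylor (f : EuclideanSpace ℝ (Fin d) → ℂ) (y : EuclideanSpace ℝ (Fin d))
    {n ϰ : ℕ} (hn : n < ϰ) :
    IsPolynomialLT ϰ fun x => ∑ j ∈ Finset.range (n + 1),
        ((1 / j.factorial : ℝ) : ℂ) * iteratedFDeriv ℝ j f y fun _ => x - y := by
  let p : MvPolynomial (Fin d) ℂ := ∑ j ∈ Finset.range (n + 1), ∑ r : Fin j → Fin d,
    MvPolynomial.C (((1 / j.factorial : ℝ) : ℂ) * partialDeriv r f y) *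
      ∏ i, (MvPolynomial.X (r i) - MvPolynomial.C (y (r i) : ℂ))
  have hp : p.totalDegree < ϰ := by
    refine lt_of_le_of_lt ?_ hn
    refine MvPolynomial.totalDegree_finsetSum_le fun j hj => ?_
    refine MvPolynomial.totalDegree_finsetSum_le fun r _ => ?_
    refine (MvPolynomial.totalDegree_mul _ _).trans ?_
    rw [MvPolynomial.totalDegree_C, zero_add]
    refine (MvPolynomial.totalDegree_finsetProd _ _).trans ?_
    refine (Finset.sum_le_card_nsmul _ _ 1 fun i _ => ?_).trans ?_
    · exact (MvPolynomial.totalDegree_sub_C_le _ _).trans (MvPolynomial.totalDegree_X _).le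
    · simp at hj ⊢; omega
  obtain ⟨c, hc⟩ := isPolynomialLT_eval p hp
  refine ⟨c, fun x => ?_⟩
  rw [← hc x]
  simp only [p, map_sum, map_mul, map_prod, map_sub, MvPolynomial.eval_C, MvPolynomial.eval_X]
  refine Finset.sum_congr rfl fun j _ => ?_
  rw [iteratedFDeriv_diag_eq_sum, Finset.mul_sum]
  refine Finset.sum_congr rfl fun r _ => ?_
  push_cast
  simp only [PiLp.sub_apply, Complex.ofReal_sub]
  ring

end Polynomials

/-! ### The error profile near a singular point and its integrals -/

section Weights

/-- The profile of the local approximation error near a singular point, as a function of the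
distance divided by the mesh size: it is of size `r ^ (min α 0)` for small `r` and of size
`r ^ (α - ϰ)` for large `r`. -/
def errorProfile (α : ℝ) (ϰ : ℕ) (r : ℝ) : ℝ := (min 1 r) ^ (min α 0) * (1 + r) ^ (α - ϰ)

theorem errorProfile_nonneg {α : ℝ} {ϰ : ℕ} {r : ℝ} (hr : 0 ≤ r) : 0 ≤ errorProfile α ϰ r :=
  mul_nonneg (Real.rpow_nonneg (le_min zero_le_one hr) _) (Real.rpow_nonneg (by linarith) _)

theorem measurable_errorProfile (α : ℝ) (ϰ : ℕ) : Measurable (errorProfile α ϰ) := by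
  unfold errorProfile
  fun_prop

theorem one_le_min_rpow {α r : ℝ} (hr : 0 < r) : 1 ≤ (min 1 r) ^ (min α 0) :=
  Real.one_le_rpow_of_pos_of_le_one_of_nonpos (lt_min zero_lt_one hr) (min_le_left _ _)
    (min_le_right _ _)

theorem min_rpow_le_errorProfile {α r D : ℝ} {ϰ : ℕ} (hα : α ≤ ϰ) (hr : 0 < r) (hrD : r ≤ D) :
    (min 1 r) ^ (min α 0) ≤ (1 + D) ^ (ϰ - α) * errorProfile α ϰ r := by
  have h1 : (1 + r) ^ (ϰ - α) ≤ (1 + D) ^ (ϰ - α) :=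
    Real.rpow_le_rpow (by linarith) (by linarith) (by linarith)
  have h2 : (1 + r) ^ (ϰ - α) * (1 + r) ^ (α - ϰ) = 1 := by
    rw [← Real.rpow_add (by linarith)]
    simp
  have h3 : 0 ≤ (min 1 r) ^ (min α 0) := Real.rpow_nonneg (le_min zero_le_one hr.le) _
  unfold errorProfile
  calc (min 1 r) ^ (min α 0) = (min 1 r) ^ (min α 0) * ((1 + r) ^ (ϰ - α) * (1 + r) ^ (α - ϰ)) := by
        rw [h2, mul_one]
    _ = (1 + r) ^ (ϰ - α) * ((min 1 r) ^ (min α 0) * (1 + r) ^ (α - ϰ)) := by ring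
    _ ≤ _ := mul_le_mul_of_nonneg_right h1 (errorProfile_nonneg hr.le)

theorem one_le_errorProfile {α r D : ℝ} {ϰ : ℕ} (hα : α ≤ ϰ) (hr : 0 < r) (hrD : r ≤ D) :
    1 ≤ (1 + D) ^ (ϰ - α) * errorProfile α ϰ r :=
  (one_le_min_rpow hr).trans (min_rpow_le_errorProfile hα hr hrD)

theorem pow_mul_rpow_le_errorProfile {α h ρ : ℝ} {ϰ : ℕ} (hα : α ≤ ϰ) (hh : 0 < h) (hρ : h ≤ ρ) :
    h ^ ϰ * ρ ^ (α - ϰ) ≤ (2 : ℝ) ^ (ϰ - α) * (h ^ α * errorProfile α ϰ (ρ / h)) := by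
  have hr : 1 ≤ ρ / h := (one_le_div hh).2 hρ
  have h0 : 0 < ρ / h := by linarith
  have h1 : h ^ ϰ * ρ ^ (α - ϰ) = h ^ α * (ρ / h) ^ (α - ϰ) := by
    rw [Real.div_rpow (by linarith) hh.le, ← Real.rpow_natCast, ← mul_div_assoc, mul_comm (h ^ α),
      mul_div_assoc, ← Real.rpow_sub hh]
    rw [mul_comm]
    congr 2
    ring
  have h2 : (ρ / h) ^ (α - ϰ) ≤ (2 : ℝ) ^ (ϰ - α) * (1 + ρ / h) ^ (α - ϰ) := by
    have h3 : (2 * (ρ / h)) ^ (α - ϰ) ≤ (1 + ρ / h) ^ (α - ϰ) :=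
      Real.rpow_le_rpow_of_nonpos (by linarith) (by linarith) (by linarith)
    rw [Real.mul_rpow zero_le_two h0.le] at h3
    calc (ρ / h) ^ (α - ϰ) = 2 ^ (ϰ - α) * (2 ^ (α - ϰ) * (ρ / h) ^ (α - ϰ)) := by
          rw [← mul_assoc, ← Real.rpow_add two_pos]
          simp
      _ ≤ _ := mul_le_mul_of_nonneg_left h3 (by positivity)
  have h4 : errorProfile α ϰ (ρ / h) = (1 + ρ / h) ^ (α - ϰ) := by
    rw [errorProfile, min_eq_left hr, Real.one_rpow, one_mul]
  rw [h1, h4]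
  calc h ^ α * (ρ / h) ^ (α - ϰ) ≤ h ^ α * (2 ^ (ϰ - α) * (1 + ρ / h) ^ (α - ϰ)) :=
        mul_le_mul_of_nonneg_left h2 (by positivity)
    _ = _ := by ring

theorem integrable_indicator_ball_norm_rpow {E : Type*} [NormedAddCommGroup E] [NormedSpace ℝ E]
    [FiniteDimensional ℝ E] [MeasurableSpace E] [BorelSpace E] (μ : Measure E)
    [μ.IsAddHaarMeasure] (hd : 1 ≤ Module.finrank ℝ E) {β : ℝ}
    (hβ : -(Module.finrank ℝ E : ℝ) < β) :
    Integrable ((Metric.ball (0 : E) 1).indicator fun x => ‖x‖ ^ β) μ := by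
  rw [integrable_indicator_iff Metric.isOpen_ball.measurableSet]
  refine integrableOn_ball_of_norm_le_rpow (C := 1) (α := -β) hd (by linarith) ?_ ?_
  · filter_upwards with x
    rw [neg_neg, one_mul, Real.norm_of_nonneg (by positivity)]
  · exact (by fun_prop : Measurable fun x : E => ‖x‖ ^ β).aestronglyMeasurable

variable {d : ℕ}

theorem lintegral_errorProfile_sq_lt_top (hd : 1 ≤ d) {α : ℝ} {ϰ : ℕ} (hα : -(d : ℝ) / 2 < α)
    (hϰ : α + d / 2 < ϰ) :
    ∫⁻ x : EuclideanSpace ℝ (Fin d), ENNReal.ofReal (errorProfile α ϰ ‖x‖) ^ 2 < ∞ := by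
  have hd0 : (0 : ℝ) < d := by exact_mod_cast hd
  have hI1 := integrable_indicator_ball_norm_rpow
    (volume : Measure (EuclideanSpace ℝ (Fin d))) (by simpa using hd) (β := 2 * min α 0) (by
      rw [finrank_euclideanSpace_fin]
      rcases min_choice α 0 with h | h <;> rw [h] <;> linarith)
  have hI2 := integrable_one_add_norm (E := EuclideanSpace ℝ (Fin d)) (μ := volume)
    (r := 2 * (ϰ - α)) (by rw [finrank_euclideanSpace_fin]; linarith)
  refine lt_of_le_of_lt (lintegral_mono fun x => ?_) (hI1.add hI2).lintegral_lt_top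
  rw [← ENNReal.ofReal_pow (errorProfile_nonneg (norm_nonneg x))]
  refine ENNReal.ofReal_le_ofReal ?_
  have hn : (0 : ℝ) ≤ ‖x‖ := norm_nonneg x
  have h1 : errorProfile α ϰ ‖x‖ ^ 2 =
      (min 1 ‖x‖) ^ (2 * min α 0) * (1 + ‖x‖) ^ (-(2 * ((ϰ : ℝ) - α))) := by
    rw [errorProfile, mul_pow, ← Real.rpow_mul_natCast (le_min zero_le_one hn),
      ← Real.rpow_mul_natCast (by linarith)]
    congr 2 <;> push_cast <;> ring
  rw [h1, Pi.add_apply]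
  have h2 : (0 : ℝ) ≤ (1 + ‖x‖) ^ (-(2 * ((ϰ : ℝ) - α))) := by positivity
  by_cases hx : ‖x‖ < 1
  · have hxb : x ∈ Metric.ball (0 : EuclideanSpace ℝ (Fin d)) 1 := by simpa using hx
    rw [Set.indicator_of_mem hxb, min_eq_right hx.le]
    have h3 : (1 + ‖x‖) ^ (-(2 * ((ϰ : ℝ) - α))) ≤ 1 :=
      Real.rpow_le_one_of_one_le_of_nonpos (by linarith) (by linarith)
    have h4 : (0 : ℝ) ≤ ‖x‖ ^ (2 * min α 0) := by positivity
    nlinarith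
  · have hxb : x ∉ Metric.ball (0 : EuclideanSpace ℝ (Fin d)) 1 := by simpa using hx
    rw [Set.indicator_of_notMem hxb, min_eq_left (not_lt.1 hx), Real.one_rpow]
    linarith

/-- Behaviour of radial integrals under translation and dilation. -/
theorem lintegral_norm_sub_div (f : ℝ → ℝ≥0∞) (hf : Measurable f) (z : EuclideanSpace ℝ (Fin d))
    {h : ℝ} (hh : 0 < h) :
    ∫⁻ x : EuclideanSpace ℝ (Fin d), f (‖x - z‖ / h) =
      ENNReal.ofReal (h ^ d) * ∫⁻ x : EuclideanSpace ℝ (Fin d), f ‖x‖ := by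
  rw [lintegral_sub_right_eq_self (fun x : EuclideanSpace ℝ (Fin d) => f (‖x‖ / h)) z]
  have h1 : ∫⁻ x : EuclideanSpace ℝ (Fin d), f (‖x‖ / h) =
      ∫⁻ y, f ‖y‖ ∂(Measure.map (fun x : EuclideanSpace ℝ (Fin d) => h⁻¹ • x) volume) := by
    rw [lintegral_map (by fun_prop) (by fun_prop)]
    refine lintegral_congr fun x => ?_
    rw [norm_smul, Real.norm_of_nonneg (by positivity), div_eq_inv_mul]
  rw [h1, Measure.map_addHaar_smul _ (by positivity), lintegral_smul_measure, smul_eq_mul,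
    finrank_euclideanSpace_fin]
  congr 2
  rw [inv_pow, inv_inv, abs_of_pos (by positivity)]

/-- The integral of `|s - s₀| ^ β` over `[0, 1]` is bounded uniformly in `s₀`. -/
theorem exists_integral_abs_sub_rpow_le {β : ℝ} (hβ : -1 < β) (hβ0 : β ≤ 0) :
    ∃ C : ℝ, 0 ≤ C ∧ ∀ s₀ : ℝ, IntervalIntegrable (fun s => |s - s₀| ^ β) volume 0 1 ∧
      ∫ s in (0 : ℝ)..1, |s - s₀| ^ β ≤ C := by
  have hI := integrable_indicator_ball_norm_rpow (volume : Measure ℝ) (by simp) (β := β)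
    (by simpa using hβ)
  set F : ℝ → ℝ := (Metric.ball (0 : ℝ) 1).indicator fun x => ‖x‖ ^ β with hF
  have hF0 : ∀ x, 0 ≤ F x := fun x => Set.indicator_nonneg (fun _ _ => by positivity) x
  have hJ : 0 ≤ ∫ x, F x := integral_nonneg hF0
  have hle : ∀ s₀ s : ℝ, |s - s₀| ^ β ≤ 1 + F (s - s₀) := by
    intro s₀ s
    by_cases hx : s - s₀ ∈ Metric.ball (0 : ℝ) 1
    · rw [hF, Set.indicator_of_mem hx, Real.norm_eq_abs]
      linarith
    · rw [hF, Set.indicator_of_notMem hx, add_zero]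
      refine Real.rpow_le_one_of_one_le_of_nonpos ?_ hβ0
      simpa using hx
  refine ⟨1 + ∫ x, F x, by linarith, fun s₀ => ?_⟩
  have hFs : Integrable fun s => F (s - s₀) := hI.comp_sub_right s₀
  have hdom : IntegrableOn (fun s => 1 + F (s - s₀)) (Set.Ioc 0 1) :=
    (integrable_const 1).add hFs.integrableOn
  have hint : IntegrableOn (fun s => |s - s₀| ^ β) (Set.Ioc 0 1) := by
    refine Integrable.mono' hdom
      (by fun_prop : Measurable fun s : ℝ => |s - s₀| ^ β).aestronglyMeasurable ?_
    filter_upwards with s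
    rw [Real.norm_of_nonneg (by positivity)]
    exact hle s₀ s
  refine ⟨(intervalIntegrable_iff_integrableOn_Ioc_of_le zero_le_one).2 hint, ?_⟩
  rw [intervalIntegral.integral_of_le zero_le_one]
  calc ∫ s in Set.Ioc 0 1, |s - s₀| ^ β ≤ ∫ s in Set.Ioc 0 1, (1 + F (s - s₀)) :=
        integral_mono hint hdom fun s => hle s₀ s
    _ = 1 + ∫ s in Set.Ioc 0 1, F (s - s₀) := by
        rw [integral_add (integrable_const 1) hFs.integrableOn]
        simp
    _ ≤ 1 + ∫ s, F (s - s₀) := by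
        have := setIntegral_le_integral (s := Set.Ioc 0 1) hFs (ae_of_all _ fun s => hF0 _)
        linarith
    _ = _ := by rw [integral_sub_right_eq_self F s₀]

/-- Negative powers of the distance to a point along a line, in terms of the parameter. The value
of `s₀` is the parameter of the point of the line closest to `z`. -/
theorem exists_norm_line_rpow_le {E : Type*} [NormedAddCommGroup E] [InnerProductSpace ℝ E]
    {β : ℝ} (hβ0 : β ≤ 0) (y z : E) {v : E} (hv : v ≠ 0) :
    ∃ s₀ : ℝ, ∀ s, s ≠ s₀ → y + s • v ≠ z ∧ ‖y + s • v - z‖ ^ β ≤ ‖v‖ ^ β * |s - s₀| ^ β := by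
  have hn : 0 < ‖v‖ := norm_pos_iff.2 hv
  refine ⟨inner ℝ (z - y) v / ‖v‖ ^ 2, fun s hs => ?_⟩
  set s₀ := inner ℝ (z - y) v / ‖v‖ ^ 2 with hs₀
  have hlow : ‖v‖ * |s - s₀| ≤ ‖y + s • v - z‖ := by
    have h1 : inner ℝ (y + s • v - z) v = ‖v‖ ^ 2 * (s - s₀) := by
      have : y + s • v - z = s • v - (z - y) := by abel
      rw [this, inner_sub_left, inner_smul_left, real_inner_self_eq_norm_sq, hs₀]
      field_simp
      simp only [Real.ringHom_apply, mul_comm]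
    have h2 := abs_real_inner_le_norm (y + s • v - z) v
    rw [h1, abs_mul, abs_of_pos (by positivity)] at h2
    have h3 : ‖v‖ * (‖v‖ * |s - s₀|) ≤ ‖v‖ * ‖y + s • v - z‖ := by linarith
    exact le_of_mul_le_mul_left h3 hn
  have hpos : 0 < ‖v‖ * |s - s₀| := mul_pos hn (abs_pos.2 (sub_ne_zero.2 hs))
  refine ⟨fun h => ?_, ?_⟩
  · rw [h, sub_self, norm_zero] at hlow
    linarith
  · rw [← Real.mul_rpow hn.le (abs_nonneg _)]
    exact Real.rpow_le_rpow_of_nonpos hpos hlow hβ0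

end Weights

/-! ### Approximation far from and near singular points -/

section LocalApproximation

variable {d N : ℕ}

theorem min_one_rpow_le {ρ β : ℝ} (hρ : 0 ≤ ρ) : (min 1 ρ) ^ β ≤ 1 + ρ ^ β := by
  rcases min_choice 1 ρ with h | h
  · rw [h, Real.one_rpow]
    linarith [Real.rpow_nonneg hρ β]
  · rw [h]
    linarith

theorem isClosed_range_fin {E : Type*} [NormedAddCommGroup E] (z : Fin N → E) :
    IsClosed (Set.range z) :=
  (Set.finite_range z).isClosed

theorem sub_pos_of_notMem_range {E : Type*} [NormedAddCommGroup E] {z : Fin N → E} {x : E}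
    (hx : x ∉ Set.range z) (k : Fin N) : 0 < ‖x - z k‖ :=
  norm_pos_iff.2 (sub_ne_zero.2 fun h => hx ⟨k, h.symm⟩)

/-- Approximation by a Taylor polynomial of the maximal order, on a convex set at distance at least
`h` from all singular points. -/
theorem exists_polynomial_of_far {α h B : ℝ} {ϰ : ℕ} (hα : α ≤ ϰ) (hϰ : 1 ≤ ϰ) (hh : 0 < h)
    (hB0 : 0 ≤ B) {z : Fin N → EuclideanSpace ℝ (Fin d)} {f : EuclideanSpace ℝ (Fin d) → ℂ}
    {Q : Set (EuclideanSpace ℝ (Fin d))} (hQ : Convex ℝ Q)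
    (hdiam : ∀ x ∈ Q, ∀ y ∈ Q, ‖x - y‖ ≤ d * h)
    (hf : ContDiffOn ℝ ϰ f (Set.range z)ᶜ)
    (hB : ∀ i : Fin ϰ → Fin d, ∀ x ∈ Q, x ∉ Set.range z →
      ‖partialDeriv i f x‖ ≤ B * (1 + ∑ k, (min 1 ‖x - z k‖) ^ (α - (ϰ : ℝ))))
    (hfar : ∀ x ∈ Q, ∀ k, h ≤ ‖x - z k‖) {y : EuclideanSpace ℝ (Fin d)} (hy : y ∈ Q) :
    ∃ P, IsPolynomialLT ϰ P ∧ ∀ x ∈ Q,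
      ‖f x - P x‖ ≤ ((d : ℝ) ^ ϰ * (d : ℝ) ^ ϰ * (1 + N + (1 + d) ^ (ϰ - α) * 2 ^ (ϰ - α))) *
        (B * (h ^ ϰ + ∑ k, h ^ α * errorProfile α ϰ (‖x - z k‖ / h))) := by
  obtain ⟨n, rfl⟩ : ∃ n, ϰ = n + 1 := ⟨ϰ - 1, by omega⟩
  refine ⟨_, isPolynomialLT_taylor f y (Nat.lt_succ_self n), fun x hx => ?_⟩
  have hseg : ∀ s ∈ Set.Icc (0 : ℝ) 1, y + s • (x - y) ∈ Q := fun s hs =>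
    hQ.add_smul_sub_mem hy hx hs
  have hX : ∀ p ∈ Q, p ∉ Set.range z := by
    rintro p hp ⟨k, rfl⟩
    have := hfar _ hp k
    rw [sub_self, norm_zero] at this
    linarith
  have hopen : IsOpen (Set.range z)ᶜ := (isClosed_range_fin z).isOpen_compl
  have hcd : ∀ p ∈ Q, ContDiffAt ℝ (n + 1 : ℕ) f p := fun p hp =>
    hf.contDiffAt (hopen.mem_nhds (hX p hp))
  set R : ℝ := ∑ k, ‖x - z k‖ ^ (α - ((n + 1 : ℕ) : ℝ)) with hR
  have hR0 : 0 ≤ R := Finset.sum_nonneg fun k _ => by positivity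
  have hpt : ∀ p ∈ Q, ∀ k, (min 1 ‖p - z k‖) ^ (α - ((n + 1 : ℕ) : ℝ)) ≤
      1 + (1 + d) ^ (((n + 1 : ℕ) : ℝ) - α) * ‖x - z k‖ ^ (α - ((n + 1 : ℕ) : ℝ)) := by
    intro p hp k
    refine (min_one_rpow_le (norm_nonneg _)).trans ?_
    have h1 : ‖x - z k‖ ≤ (1 + d) * ‖p - z k‖ := by
      have h2 : ‖x - z k‖ ≤ ‖x - p‖ + ‖p - z k‖ := norm_sub_le_norm_sub_add_norm_sub _ _ _
      have h3 := hdiam x hx p hp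
      have h4 := hfar p hp k
      have h5 : (d : ℝ) * h ≤ d * ‖p - z k‖ := by gcongr
      linarith
    have h0 : 0 < ‖x - z k‖ := hh.trans_le (hfar x hx k)
    have h2 : ((1 + d) * ‖p - z k‖) ^ (α - ((n + 1 : ℕ) : ℝ)) ≤
        ‖x - z k‖ ^ (α - ((n + 1 : ℕ) : ℝ)) :=
      Real.rpow_le_rpow_of_nonpos h0 h1 (by linarith)
    rw [Real.mul_rpow (by positivity) (norm_nonneg _)] at h2
    have h3 : (1 + (d : ℝ)) ^ (((n + 1 : ℕ) : ℝ) - α) * (1 + d) ^ (α - ((n + 1 : ℕ) : ℝ)) = 1 := by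
      rw [← Real.rpow_add (by positivity)]
      simp
    have h4 := mul_le_mul_of_nonneg_left h2
      (by positivity : 0 ≤ (1 + (d : ℝ)) ^ (((n + 1 : ℕ) : ℝ) - α))
    rw [← mul_assoc, h3, one_mul] at h4
    linarith
  set G : ℝ := (d : ℝ) ^ (n + 1) * (((d : ℝ) * h) ^ (n + 1) *
    (B * (1 + N + (1 + d) ^ (((n + 1 : ℕ) : ℝ) - α) * R))) with hG
  have hmain := norm_sub_taylor_le_integral (f := f) (n := n) (y := y) (v := x - y)
    Set.countable_empty (g := fun _ => G) intervalIntegrable_const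
    (fun s hs => (hcd _ (hseg s hs)).of_le (by exact_mod_cast n.le_succ))
    (fun s hs => ⟨hcd _ (hseg s hs.1), by
      refine (norm_iteratedFDeriv_diag_le fun r => hB r _ (hseg s hs.1)
        (hX _ (hseg s hs.1))).trans ?_
      rw [hG]
      have h1 : ∑ k, (min 1 ‖y + s • (x - y) - z k‖) ^ (α - ((n + 1 : ℕ) : ℝ)) ≤
          N + (1 + d) ^ (((n + 1 : ℕ) : ℝ) - α) * R := by
        refine (Finset.sum_le_sum fun k _ => hpt _ (hseg s hs.1) k).trans (le_of_eq ?_)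
        rw [Finset.sum_add_distrib, ← Finset.mul_sum, ← hR]
        simp only [Finset.sum_const, Finset.card_univ, Fintype.card_fin, nsmul_eq_mul, mul_one]
      have h2 := pow_le_pow_left₀ (norm_nonneg _) (hdiam x hx y hy) (n + 1)
      exact mul_le_mul_of_nonneg_left (mul_le_mul h2
        (mul_le_mul_of_nonneg_left (by linarith) hB0)
        (mul_nonneg hB0 (add_nonneg zero_le_one (Finset.sum_nonneg fun k _ => by positivity)))
        (by positivity)) (by positivity)⟩)
  rw [add_sub_cancel, intervalIntegral.integral_const, sub_zero, one_smul] at hmain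
  refine hmain.trans ?_
  have hRle : h ^ (n + 1) * R ≤ 2 ^ (((n + 1 : ℕ) : ℝ) - α) *
      ∑ k, h ^ α * errorProfile α (n + 1) (‖x - z k‖ / h) := by
    rw [hR, Finset.mul_sum, Finset.mul_sum]
    exact Finset.sum_le_sum fun k _ => pow_mul_rpow_le_errorProfile hα hh (hfar x hx k)
  set Φ := ∑ k, h ^ α * errorProfile α (n + 1) (‖x - z k‖ / h) with hΦ
  have hΦ0 : 0 ≤ Φ := Finset.sum_nonneg fun k _ =>
    mul_nonneg (by positivity) (errorProfile_nonneg (by positivity))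
  set c₁ : ℝ := (1 + (d : ℝ)) ^ (((n + 1 : ℕ) : ℝ) - α) with hc₁
  set c₂ : ℝ := (2 : ℝ) ^ (((n + 1 : ℕ) : ℝ) - α) with hc₂
  have hc₁0 : 0 ≤ c₁ := by positivity
  have hc₂0 : 0 ≤ c₂ := by positivity
  calc G = (d : ℝ) ^ (n + 1) * (d : ℝ) ^ (n + 1) *
        (B * ((1 + N) * h ^ (n + 1) + c₁ * (h ^ (n + 1) * R))) := by
        rw [hG, mul_pow]; ring
    _ ≤ (d : ℝ) ^ (n + 1) * (d : ℝ) ^ (n + 1) *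
        (B * ((1 + N) * h ^ (n + 1) + c₁ * (c₂ * Φ))) := by gcongr
    _ ≤ (d : ℝ) ^ (n + 1) * (d : ℝ) ^ (n + 1) *
        (B * ((1 + N + c₁ * c₂) * (h ^ (n + 1) + Φ))) := by
        gcongr
        have e1 : 0 ≤ c₁ * c₂ * h ^ (n + 1) := by positivity
        have e2 : 0 ≤ (1 + (N : ℝ)) * Φ := by positivity
        linarith
    _ = _ := by ring

/-- For `α ≤ 0` no polynomial is needed at distance of order `h` from a singular point. -/
theorem norm_le_of_near_of_nonpos {α h B : ℝ} {ϰ : ℕ} (hα : α ≤ 0) (hh : 0 < h) (hh1 : h ≤ 1)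
    (hB0 : 0 ≤ B) {z : Fin N → EuclideanSpace ℝ (Fin d)} {f : EuclideanSpace ℝ (Fin d) → ℂ}
    {x : EuclideanSpace ℝ (Fin d)} (hx : x ∉ Set.range z)
    (hB : ‖f x‖ ≤ B * (1 + ∑ k, (min 1 ‖x - z k‖) ^ α)) {k₀ : Fin N}
    (hnear : ‖x - z k₀‖ ≤ (1 + d) * h) :
    ‖f x‖ ≤ ((2 + d) ^ (ϰ - α) * (1 + 2 * N)) *
      (B * ∑ k, h ^ α * errorProfile α ϰ (‖x - z k‖ / h)) := by
  have hαϰ : α ≤ ϰ := hα.trans (Nat.cast_nonneg _)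
  have hmin : min α 0 = α := min_eq_left hα
  set c : ℝ := (2 + (d : ℝ)) ^ (ϰ - α) with hc
  have hc' : (1 + (1 + (d : ℝ))) ^ (ϰ - α) = c := by rw [hc]; congr 1; ring
  have hc0 : 0 ≤ c := by positivity
  have hr : ∀ k, 0 < ‖x - z k‖ / h := fun k => div_pos (sub_pos_of_notMem_range hx k) hh
  have hr₀ : ‖x - z k₀‖ / h ≤ 1 + d := by rwa [div_le_iff₀ hh]
  have hha : 1 ≤ h ^ α := Real.one_le_rpow_of_pos_of_le_one_of_nonpos hh hh1 hα
  have hφ : ∀ k, 0 ≤ errorProfile α ϰ (‖x - z k‖ / h) := fun k => errorProfile_nonneg (hr k).le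
  have h0 : 1 ≤ c * errorProfile α ϰ (‖x - z k₀‖ / h) := by
    rw [← hc']; exact one_le_errorProfile hαϰ (hr k₀) hr₀
  set Φ := ∑ k, errorProfile α ϰ (‖x - z k‖ / h) with hΦ
  have hΦk : ∀ k, errorProfile α ϰ (‖x - z k‖ / h) ≤ Φ := fun k =>
    Finset.single_le_sum (f := fun k => errorProfile α ϰ (‖x - z k‖ / h)) (fun k _ => hφ k)
      (Finset.mem_univ k)
  have hΦ0 : 0 ≤ Φ := (hφ k₀).trans (hΦk k₀)
  have h1Φ : 1 ≤ c * Φ := h0.trans (mul_le_mul_of_nonneg_left (hΦk k₀) hc0)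
  have hterm : ∀ k, (min 1 ‖x - z k‖) ^ α ≤ h ^ α * (2 * (c * Φ)) := by
    intro k
    have h1 : h * min 1 (‖x - z k‖ / h) ≤ min 1 ‖x - z k‖ := by
      rw [mul_min_of_nonneg _ _ hh.le, mul_div_cancel₀ _ hh.ne', mul_one]
      exact min_le_min_right _ hh1
    have hm0 : 0 < min 1 (‖x - z k‖ / h) := lt_min one_pos (hr k)
    have h2 := Real.rpow_le_rpow_of_nonpos (mul_pos hh hm0) h1 hα
    rw [Real.mul_rpow hh.le hm0.le] at h2
    refine h2.trans (mul_le_mul_of_nonneg_left ?_ (by positivity))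
    rcases le_total (‖x - z k‖ / h) (1 + d) with h3 | h3
    · have h4 := min_rpow_le_errorProfile hαϰ (hr k) h3
      rw [hmin, hc'] at h4
      have := mul_le_mul_of_nonneg_left (hΦk k) hc0
      linarith
    · have h4 : (1 : ℝ) ≤ ‖x - z k‖ / h := le_trans (by simp) h3
      rw [min_eq_left h4, Real.one_rpow]
      linarith
  refine hB.trans ?_
  have hsum : ∑ k, (min 1 ‖x - z k‖) ^ α ≤ N * (h ^ α * (2 * (c * Φ))) := by
    refine (Finset.sum_le_sum fun k _ => hterm k).trans (le_of_eq ?_)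
    simp
  have h5 : 1 ≤ h ^ α * (c * Φ) := one_le_mul_of_one_le_of_one_le hha h1Φ
  rw [← Finset.mul_sum]
  calc B * (1 + ∑ k, (min 1 ‖x - z k‖) ^ α)
      ≤ B * (h ^ α * (c * Φ) + N * (h ^ α * (2 * (c * Φ)))) := by gcongr
    _ = _ := by ring

/-- Taylor approximation of order `⌈α⌉` along a segment that may pass through singular points, for
`α > 0`. The function `g` is an extension of `f` across the singular points on the segment; its
Taylor remainder is an integral of `|s - s₀| ^ (α - ⌈α⌉)`, with an exponent in `(-1, 0]`. -/
theorem exists_norm_sub_taylor_le (d N : ℕ) {α : ℝ} (hα : 0 < α) {ϰ : ℕ} (hαϰ : α ≤ ϰ) :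
    ∃ C : ℝ, 0 ≤ C ∧ ∀ {h B : ℝ}, 0 < h → h ≤ 1 → 0 ≤ B →
      ∀ {z : Fin N → EuclideanSpace ℝ (Fin d)} {f g : EuclideanSpace ℝ (Fin d) → ℂ}
        {Q : Set (EuclideanSpace ℝ (Fin d))}, Convex ℝ Q →
        (∀ x ∈ Q, ∀ y ∈ Q, ‖x - y‖ ≤ d * h) →
        ContDiffOn ℝ ϰ f (Set.range z)ᶜ → Set.EqOn f g (Set.range z)ᶜ →
        (∀ i : Fin ⌈α⌉₊ → Fin d, ∀ x ∈ Q, x ∉ Set.range z →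
          ‖partialDeriv i f x‖ ≤ B * (1 + ∑ k, (min 1 ‖x - z k‖) ^ (α - (⌈α⌉₊ : ℝ)))) →
        ∀ y ∈ Q, ∀ x ∈ Q, x ≠ y →
        (∀ s ∈ Set.Icc (0 : ℝ) 1, ContDiffAt ℝ (⌈α⌉₊ - 1 : ℕ) g (y + s • (x - y))) →
        ‖g x - ∑ j ∈ Finset.range ⌈α⌉₊,
          ((1 / j.factorial : ℝ) : ℂ) * iteratedFDeriv ℝ j g y fun _ => x - y‖ ≤
          C * (B * h ^ α) := by
  obtain ⟨n, hn⟩ : ∃ n, ⌈α⌉₊ = n + 1 :=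
    ⟨⌈α⌉₊ - 1, by have := Nat.ceil_pos.2 hα; omega⟩
  have hnα : α ≤ (n + 1 : ℕ) := hn ▸ Nat.le_ceil α
  have hnα' : ((n + 1 : ℕ) : ℝ) < α + 1 := hn ▸ Nat.ceil_lt_add_one hα.le
  have hnϰ : n + 1 ≤ ϰ := hn ▸ Nat.ceil_le.2 hαϰ
  rw [hn, Nat.add_sub_cancel]
  set β : ℝ := α - ((n + 1 : ℕ) : ℝ) with hβ
  have hβ0 : β ≤ 0 := by linarith
  obtain ⟨J, hJ0, hJ⟩ := exists_integral_abs_sub_rpow_le (β := β) (by linarith) hβ0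
  refine ⟨(d : ℝ) ^ (n + 1) * ((1 + N) * (d : ℝ) ^ (n + 1) + N * J * (d : ℝ) ^ α), by positivity,
    ?_⟩
  intro h B hh hh1 hB0 z f g Q hQ hdiam hf hfg hB y hy x hx hxy hg
  have hv : x - y ≠ 0 := sub_ne_zero.2 hxy
  have hvn : 0 < ‖x - y‖ := norm_pos_iff.2 hv
  have hopen : IsOpen (Set.range z)ᶜ := (isClosed_range_fin z).isOpen_compl
  choose s₀ hs₀ using fun k => exists_norm_line_rpow_le hβ0 y (z k) hv
  have hseg : ∀ s ∈ Set.Icc (0 : ℝ) 1, y + s • (x - y) ∈ Q := fun s hs =>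
    hQ.add_smul_sub_mem hy hx hs
  let G : ℝ → ℝ := fun s => (d : ℝ) ^ (n + 1) * (‖x - y‖ ^ (n + 1) *
    (B * (1 + N + ∑ k, ‖x - y‖ ^ β * |s - s₀ k| ^ β)))
  have hsumint : IntervalIntegrable (fun s => ∑ k, ‖x - y‖ ^ β * |s - s₀ k| ^ β) volume 0 1 := by
    have := IntervalIntegrable.sum (μ := volume) (a := 0) (b := 1) Finset.univ
      (f := fun k s => ‖x - y‖ ^ β * |s - s₀ k| ^ β) fun k _ => (hJ (s₀ k)).1.const_mul _
    simpa only [Finset.sum_fn] using this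
  have hGint : IntervalIntegrable G volume 0 1 :=
    (((intervalIntegrable_const.add hsumint).const_mul B).const_mul _).const_mul _
  have hmain := norm_sub_taylor_le_integral (f := g) (n := n) (y := y) (v := x - y)
    (F := Set.range s₀) (Set.finite_range s₀).countable hGint hg
    (fun s hs => by
      have hp : y + s • (x - y) ∈ (Set.range z)ᶜ := by
        rintro ⟨k, hk⟩
        exact (hs₀ k s fun h => hs.2 ⟨k, h.symm⟩).1 hk.symm
      have hev : f =ᶠ[nhds (y + s • (x - y))] g := hfg.eventuallyEq_of_mem (hopen.mem_nhds hp)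
      have hcd : ContDiffAt ℝ (n + 1 : ℕ) f (y + s • (x - y)) :=
        (hf.contDiffAt (hopen.mem_nhds hp)).of_le (by exact_mod_cast hnϰ)
      refine ⟨hcd.congr_of_eventuallyEq hev.symm, ?_⟩
      rw [← (hev.iteratedFDeriv ℝ (n + 1)).eq_of_nhds]
      refine (norm_iteratedFDeriv_diag_le fun r => ?_).trans
        (mul_le_mul_of_nonneg_left (mul_le_mul_of_nonneg_left (le_refl _) (by positivity))
          (by positivity))
      refine (hB r _ (hseg s hs.1) hp).trans (mul_le_mul_of_nonneg_left ?_ hB0)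
      have : ∀ k ∈ (Finset.univ : Finset (Fin N)), (min 1 ‖y + s • (x - y) - z k‖) ^ β ≤
          1 + ‖x - y‖ ^ β * |s - s₀ k| ^ β := fun k _ =>
        (min_one_rpow_le (norm_nonneg _)).trans
          (by linarith [(hs₀ k s fun h => hs.2 ⟨k, h.symm⟩).2])
      have h2 := Finset.sum_le_sum this
      rw [Finset.sum_add_distrib] at h2
      simp only [Finset.sum_const, Finset.card_univ, Fintype.card_fin, nsmul_eq_mul, mul_one] at h2
      linarith)
  rw [add_sub_cancel] at hmain
  refine hmain.trans ?_
  have hint : ∫ s in (0 : ℝ)..1, G s ≤ (d : ℝ) ^ (n + 1) * (‖x - y‖ ^ (n + 1) *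
      (B * (1 + N + N * (‖x - y‖ ^ β * J)))) := by
    simp only [G]
    rw [intervalIntegral.integral_const_mul, intervalIntegral.integral_const_mul,
      intervalIntegral.integral_const_mul,
      intervalIntegral.integral_add intervalIntegrable_const hsumint,
      intervalIntegral.integral_finsetSum fun k _ => (hJ (s₀ k)).1.const_mul _]
    simp only [intervalIntegral.integral_const_mul, intervalIntegral.integral_const, sub_zero,
      one_smul]
    have : ∑ k, ‖x - y‖ ^ β * ∫ s in (0 : ℝ)..1, |s - s₀ k| ^ β ≤ N * (‖x - y‖ ^ β * J) := by
      refine (Finset.sum_le_sum fun k _ =>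
        mul_le_mul_of_nonneg_left (hJ (s₀ k)).2 (by positivity)).trans (le_of_eq ?_)
      simp
    gcongr
  refine hint.trans ?_
  have hvd : ‖x - y‖ ≤ d * h := hdiam x hx y hy
  have h1 : ‖x - y‖ ^ (n + 1) ≤ (d : ℝ) ^ (n + 1) * h ^ α := by
    refine (pow_le_pow_left₀ hvn.le hvd _).trans ?_
    rw [mul_pow]
    gcongr
    rw [← Real.rpow_natCast]
    exact Real.rpow_le_rpow_of_exponent_ge hh hh1 hnα
  have h2 : ‖x - y‖ ^ (n + 1) * ‖x - y‖ ^ β ≤ (d : ℝ) ^ α * h ^ α := by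
    rw [← Real.rpow_natCast, ← Real.rpow_add hvn, hβ, add_sub_cancel,
      ← Real.mul_rpow (by positivity) hh.le]
    exact Real.rpow_le_rpow hvn.le hvd hα.le
  calc (d : ℝ) ^ (n + 1) * (‖x - y‖ ^ (n + 1) * (B * (1 + N + N * (‖x - y‖ ^ β * J))))
      = (d : ℝ) ^ (n + 1) * (B * ((1 + N) * ‖x - y‖ ^ (n + 1) +
          N * J * (‖x - y‖ ^ (n + 1) * ‖x - y‖ ^ β))) := by ring
    _ ≤ (d : ℝ) ^ (n + 1) * (B * ((1 + N) * ((d : ℝ) ^ (n + 1) * h ^ α) +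
          N * J * ((d : ℝ) ^ α * h ^ α))) := by gcongr
    _ = _ := by ring

end LocalApproximation

/-! ### Approximation on convex sets -/

section ApproximationOnConvexSets

variable {d N : ℕ}

/-- In dimension at least two almost every segment from a given point avoids a finite set. -/
theorem ae_segment_notMem_range (hd : 2 ≤ d) (z : Fin N → EuclideanSpace ℝ (Fin d))
    {y : EuclideanSpace ℝ (Fin d)} (hy : y ∉ Set.range z) :
    ∀ᵐ x : EuclideanSpace ℝ (Fin d), ∀ s : ℝ, y + s • (x - y) ∉ Set.range z := by
  have hk : ∀ k, ∀ᵐ x : EuclideanSpace ℝ (Fin d), x - y ∉ Submodule.span ℝ {z k - y} := by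
    intro k
    have hne : Submodule.span ℝ {z k - y} ≠ ⊤ := by
      intro h
      have h1 := finrank_span_le_card (R := ℝ) ({z k - y} : Set (EuclideanSpace ℝ (Fin d)))
      rw [h, finrank_top, finrank_euclideanSpace_fin] at h1
      simp at h1
      omega
    have h0 := Measure.addHaar_submodule (volume : Measure (EuclideanSpace ℝ (Fin d))) _ hne
    have h1 : ∀ᵐ x : EuclideanSpace ℝ (Fin d), x ∉ Submodule.span ℝ {z k - y} := by
      rw [ae_iff]; simpa using h0
    exact (measurePreserving_sub_right volume y).quasiMeasurePreserving.ae h1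
  filter_upwards [ae_all_iff.2 hk] with x hx s
  rintro ⟨k, hzk⟩
  have hs : s ≠ 0 := by
    rintro rfl
    exact hy ⟨k, by simpa using hzk⟩
  refine hx k (Submodule.mem_span_singleton.2 ⟨s⁻¹, ?_⟩)
  rw [hzk, add_sub_cancel_left, smul_smul, inv_mul_cancel₀ hs, one_smul]

theorem norm_partialDeriv_zero (i : Fin 0 → Fin d) (f : EuclideanSpace ℝ (Fin d) → ℂ)
    (x : EuclideanSpace ℝ (Fin d)) : ‖partialDeriv i f x‖ = ‖f x‖ := by
  rw [partialDeriv, iteratedFDeriv_zero_apply]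

theorem volume_range_fin (hd : 1 ≤ d) (z : Fin N → EuclideanSpace ℝ (Fin d)) :
    volume (Set.range z) = 0 := by
  have : Nonempty (Fin d) := ⟨⟨0, hd⟩⟩
  exact (Set.finite_range z).measure_zero _

/-- Polynomial approximation, at mesh size `h`, of a function with singularities at the points
`z k`, on a convex set of diameter at most `d h`. -/
theorem exists_polynomial_approx (hd : 1 ≤ d) (N : ℕ) {α : ℝ} {ϰ : ℕ} (hα : α ≤ ϰ)
    (hϰ : 1 ≤ ϰ) :
    ∃ C : ℝ, 0 ≤ C ∧ ∀ {h B : ℝ}, 0 < h → h ≤ 1 → 0 ≤ B →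
      ∀ {z : Fin N → EuclideanSpace ℝ (Fin d)} {f : EuclideanSpace ℝ (Fin d) → ℂ}
        {Q : Set (EuclideanSpace ℝ (Fin d))}, Convex ℝ Q →
        (∀ x ∈ Q, ∀ y ∈ Q, ‖x - y‖ ≤ d * h) → volume Q ≠ 0 →
        ContDiffOn ℝ ϰ f (Set.range z)ᶜ →
        (∀ m : ℕ, m ≤ ϰ → ∀ i : Fin m → Fin d, ∀ x ∈ Q, x ∉ Set.range z →
          ‖partialDeriv i f x‖ ≤ B * (1 + ∑ k, (min 1 ‖x - z k‖) ^ (α - (m : ℝ)))) →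
        (d = 1 → 0 < α → ∃ g : EuclideanSpace ℝ (Fin d) → ℂ,
          ContDiff ℝ (⌈α⌉₊ - 1 : ℕ) g ∧ Set.EqOn f g (Set.range z)ᶜ) →
        ∃ P, IsPolynomialLT ϰ P ∧ ∀ᵐ x, x ∈ Q →
          ‖f x - P x‖ ≤ C * (B * (h ^ ϰ + ∑ k, h ^ α * errorProfile α ϰ (‖x - z k‖ / h))) := by
  set C₁ : ℝ := (d : ℝ) ^ ϰ * (d : ℝ) ^ ϰ * (1 + N + (1 + d) ^ (ϰ - α) * 2 ^ (ϰ - α)) with hC₁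
  set C₂ : ℝ := (2 + (d : ℝ)) ^ (ϰ - α) * (1 + 2 * N) with hC₂
  have hC₁0 : 0 ≤ C₁ := by positivity
  have hC₂0 : 0 ≤ C₂ := by positivity
  obtain ⟨C₃, hC₃0, hC₃⟩ : ∃ C₃ : ℝ, 0 ≤ C₃ ∧ (0 < α → _) := by
    by_cases h : 0 < α
    · obtain ⟨C, hC, H⟩ := exists_norm_sub_taylor_le d N h hα
      exact ⟨C, hC, fun _ => @H⟩
    · exact ⟨0, le_rfl, fun h' => absurd h' h⟩
  set c : ℝ := (2 + (d : ℝ)) ^ (ϰ - α) with hc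
  have hc0 : 0 ≤ c := by positivity
  refine ⟨C₁ + C₂ + C₃ * c, by positivity, ?_⟩
  intro h B hh hh1 hB0 z f Q hQ hdiam hvol hf hB hg
  have hXnull : ∀ᵐ x : EuclideanSpace ℝ (Fin d), x ∉ Set.range z :=
    measure_eq_zero_iff_ae_notMem.1 (volume_range_fin hd z)
  have hΦ : ∀ x, 0 ≤ ∑ k, h ^ α * errorProfile α ϰ (‖x - z k‖ / h) := fun x =>
    Finset.sum_nonneg fun k _ =>
      mul_nonneg (by positivity) (errorProfile_nonneg (by positivity))
  -- a point of `Q` outside the singular set, used as the centre of the expansions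
  obtain ⟨y, hyQ, hyX⟩ : ∃ y ∈ Q, y ∉ Set.range z := by
    by_contra! hcon
    exact hvol (measure_mono_null hcon (volume_range_fin hd z))
  have hEpos : ∀ x, 0 ≤ B * (h ^ ϰ + ∑ k, h ^ α * errorProfile α ϰ (‖x - z k‖ / h)) := fun x =>
    mul_nonneg hB0 (add_nonneg (by positivity) (hΦ x))
  by_cases hfar : ∀ x ∈ Q, ∀ k, h ≤ ‖x - z k‖
  · obtain ⟨P, hP, hPf⟩ := exists_polynomial_of_far hα hϰ hh hB0 hQ hdiam hf (hB ϰ le_rfl) hfar hyQ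
    refine ⟨P, hP, ae_of_all _ fun x hx => (hPf x hx).trans ?_⟩
    refine mul_le_mul_of_nonneg_right ?_ (hEpos x)
    have : 0 ≤ C₃ * c := by positivity
    linarith
  push Not at hfar
  obtain ⟨x₁, hx₁, k₀, hk₀⟩ := hfar
  have hnear : ∀ x ∈ Q, ‖x - z k₀‖ ≤ (1 + d) * h := by
    intro x hx
    have h1 : ‖x - z k₀‖ ≤ ‖x - x₁‖ + ‖x₁ - z k₀‖ := norm_sub_le_norm_sub_add_norm_sub _ _ _
    have h2 := hdiam x hx x₁ hx₁
    linarith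
  rcases le_or_gt α 0 with hα0 | hα0
  · refine ⟨_, IsPolynomialLT.zero ϰ, ?_⟩
    filter_upwards [hXnull] with x hxX hx
    rw [sub_zero]
    have h0 := hB 0 (Nat.zero_le _) (fun i => i.elim0) x hx hxX
    rw [norm_partialDeriv_zero, Nat.cast_zero, sub_zero] at h0
    refine (norm_le_of_near_of_nonpos (ϰ := ϰ) hα0 hh hh1 hB0 hxX h0 (hnear x hx)).trans ?_
    refine mul_le_mul ?_ (mul_le_mul_of_nonneg_left ?_ hB0) (mul_nonneg hB0 (hΦ x)) (by positivity)
    · have : 0 ≤ C₃ * c := by positivity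
      linarith
    · have : 0 ≤ h ^ ϰ := by positivity
      linarith
  · have hm : ⌈α⌉₊ - 1 + 1 = ⌈α⌉₊ := by
      have := Nat.ceil_pos.2 hα0
      omega
    have hmϰ : ⌈α⌉₊ ≤ ϰ := Nat.ceil_le.2 hα
    obtain ⟨g, hfg, hgs⟩ : ∃ g : EuclideanSpace ℝ (Fin d) → ℂ, Set.EqOn f g (Set.range z)ᶜ ∧
        ∀ᵐ x, x ∈ Q → ∀ s ∈ Set.Icc (0 : ℝ) 1,
          ContDiffAt ℝ (⌈α⌉₊ - 1 : ℕ) g (y + s • (x - y)) := by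
      rcases Nat.lt_or_ge d 2 with hd2 | hd2
      · obtain ⟨g, hg1, hg2⟩ := hg (by omega) hα0
        exact ⟨g, hg2, ae_of_all _ fun x _ s _ => hg1.contDiffAt⟩
      · refine ⟨f, fun _ _ => rfl, ?_⟩
        filter_upwards [ae_segment_notMem_range hd2 z hyX] with x hx _ s _
        exact (hf.contDiffAt ((isClosed_range_fin z).isOpen_compl.mem_nhds (hx s))).of_le
          (by exact_mod_cast (Nat.sub_le _ _).trans hmϰ)
    refine ⟨_, isPolynomialLT_taylor g y (n := ⌈α⌉₊ - 1) (ϰ := ϰ) (by omega), ?_⟩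
    have hyne : ∀ᵐ x : EuclideanSpace ℝ (Fin d), x ≠ y := by
      have := volume_range_fin hd (fun _ : Fin 1 => y)
      rw [Set.range_const] at this
      exact measure_eq_zero_iff_ae_notMem.1 this
    filter_upwards [hXnull, hgs, hyne] with x hxX hxs hxy hx
    rw [hm, hfg hxX]
    refine (hC₃ hα0 hh hh1 hB0 hQ hdiam hf hfg (hB _ hmϰ) y hyQ x hx hxy (hxs hx)).trans ?_
    have h1 : 1 ≤ c * errorProfile α ϰ (‖x - z k₀‖ / h) := by
      have := one_le_errorProfile (D := 1 + d) hα (div_pos (sub_pos_of_notMem_range hxX k₀) hh)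
        ((div_le_iff₀ hh).2 (hnear x hx))
      rwa [← add_assoc, one_add_one_eq_two] at this
    have h2 : h ^ α * errorProfile α ϰ (‖x - z k₀‖ / h) ≤
        ∑ k, h ^ α * errorProfile α ϰ (‖x - z k‖ / h) :=
      Finset.single_le_sum (f := fun k => h ^ α * errorProfile α ϰ (‖x - z k‖ / h))
        (fun k _ => mul_nonneg (by positivity) (errorProfile_nonneg (by positivity)))
        (Finset.mem_univ k₀)
    have h3 : h ^ α ≤ c * (h ^ ϰ + ∑ k, h ^ α * errorProfile α ϰ (‖x - z k‖ / h)) := by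
      have h4 : h ^ α * 1 ≤ h ^ α * (c * errorProfile α ϰ (‖x - z k₀‖ / h)) :=
        mul_le_mul_of_nonneg_left h1 (by positivity)
      have h5 := mul_le_mul_of_nonneg_left h2 hc0
      have h6 : 0 ≤ c * h ^ ϰ := by positivity
      linarith
    calc C₃ * (B * h ^ α)
        ≤ C₃ * (B * (c * (h ^ ϰ + ∑ k, h ^ α * errorProfile α ϰ (‖x - z k‖ / h)))) := by gcongr
      _ = C₃ * c * (B * (h ^ ϰ + ∑ k, h ^ α * errorProfile α ϰ (‖x - z k‖ / h))) := by ring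
      _ ≤ _ := by
        refine mul_le_mul_of_nonneg_right ?_ (hEpos x)
        linarith

/-- The unapproximated function satisfies the error bound with mesh size one. -/
theorem norm_le_errorProfile {α B : ℝ} {ϰ : ℕ} (hα : α ≤ ϰ) (hB0 : 0 ≤ B)
    {z : Fin N → EuclideanSpace ℝ (Fin d)} {f : EuclideanSpace ℝ (Fin d) → ℂ}
    {x : EuclideanSpace ℝ (Fin d)} (hx : x ∉ Set.range z)
    (hB : ‖f x‖ ≤ B * (1 + ∑ k, (min 1 ‖x - z k‖) ^ α)) :
    ‖f x‖ ≤ (1 + N + (2 : ℝ) ^ (ϰ - α)) * (B * (1 + ∑ k, errorProfile α ϰ ‖x - z k‖)) := by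
  have hterm : ∀ k, (min 1 ‖x - z k‖) ^ α ≤ 1 + 2 ^ (ϰ - α) * errorProfile α ϰ ‖x - z k‖ := by
    intro k
    have hr := sub_pos_of_notMem_range hx k
    have hφ := errorProfile_nonneg (α := α) (ϰ := ϰ) hr.le
    have hm : 0 < min 1 ‖x - z k‖ := lt_min one_pos hr
    rcases le_total 1 ‖x - z k‖ with h1 | h1
    · rw [min_eq_left h1, Real.one_rpow]
      have : 0 ≤ (2 : ℝ) ^ (ϰ - α) * errorProfile α ϰ ‖x - z k‖ := by positivity
      linarith
    · have h2 := min_rpow_le_errorProfile hα hr h1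
      rw [one_add_one_eq_two] at h2
      have h3 : (min 1 ‖x - z k‖) ^ α ≤ (min 1 ‖x - z k‖) ^ (min α 0) :=
        Real.rpow_le_rpow_of_exponent_ge hm (min_le_left _ _) (min_le_left _ _)
      linarith
  refine hB.trans ?_
  set Φ := ∑ k, errorProfile α ϰ ‖x - z k‖ with hΦ
  have hΦ0 : 0 ≤ Φ := Finset.sum_nonneg fun k _ => errorProfile_nonneg (norm_nonneg _)
  have hsum : ∑ k, (min 1 ‖x - z k‖) ^ α ≤ N + 2 ^ (ϰ - α) * Φ := by
    refine (Finset.sum_le_sum fun k _ => hterm k).trans (le_of_eq ?_)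
    rw [Finset.sum_add_distrib, ← Finset.mul_sum, ← hΦ]
    simp only [Finset.sum_const, Finset.card_univ, Fintype.card_fin, nsmul_eq_mul, mul_one]
  have hc : 0 ≤ (2 : ℝ) ^ (ϰ - α) := by positivity
  set c : ℝ := (2 : ℝ) ^ (ϰ - α)
  have e1 : 0 ≤ (1 + N) * Φ := by positivity
  have e2 : 1 + ∑ k, (min 1 ‖x - z k‖) ^ α ≤ (1 + N + c) * (1 + Φ) := by linarith
  calc B * (1 + ∑ k, (min 1 ‖x - z k‖) ^ α) ≤ B * ((1 + N + c) * (1 + Φ)) := by gcongr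
    _ = _ := by ring

end ApproximationOnConvexSets

/-! ### Division of unit cubes into cells -/

section Cells

variable {d : ℕ}

/-- The half-open box with lower corner `L` and upper corner `U`. -/
def box (L U : Fin d → ℝ) : Set (EuclideanSpace ℝ (Fin d)) := {x | ∀ r, L r ≤ x r ∧ x r < U r}

theorem box_eq_preimage (L U : Fin d → ℝ) :
    box L U = (fun x : EuclideanSpace ℝ (Fin d) => x.ofLp) ⁻¹'
      Set.univ.pi fun r => Set.Ico (L r) (U r) := by
  ext x
  simp [box]

theorem measurableSet_box (L U : Fin d → ℝ) : MeasurableSet (box L U) := by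
  rw [box_eq_preimage]
  exact (PiLp.volume_preserving_ofLp (Fin d)).measurable
    (MeasurableSet.univ_pi fun _ => measurableSet_Ico)

theorem volume_box (L U : Fin d → ℝ) : volume (box L U) = ∏ r, ENNReal.ofReal (U r - L r) := by
  rw [box_eq_preimage, (PiLp.volume_preserving_ofLp (Fin d)).measure_preimage
    (MeasurableSet.univ_pi fun _ => measurableSet_Ico).nullMeasurableSet, Real.volume_pi_Ico]

theorem convex_box (L U : Fin d → ℝ) : Convex ℝ (box L U) := fun _ hx _ hy _ _ ha hb hab r =>
  convex_Ico (L r) (U r) (hx r) (hy r) ha hb hab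

theorem norm_sub_le_of_mem_box {L U : Fin d → ℝ} {h : ℝ} (hh : 0 ≤ h)
    (hLU : ∀ r, U r - L r ≤ h) {x y : EuclideanSpace ℝ (Fin d)} (hx : x ∈ box L U)
    (hy : y ∈ box L U) : ‖x - y‖ ≤ d * h := by
  rw [EuclideanSpace.norm_eq]
  refine Real.sqrt_le_iff.2 ⟨by positivity, ?_⟩
  have h1 : ∀ r ∈ (Finset.univ : Finset (Fin d)), ‖(x - y) r‖ ^ 2 ≤ h ^ 2 := by
    intro r _
    refine pow_le_pow_left₀ (norm_nonneg _) ?_ 2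
    rw [PiLp.sub_apply, Real.norm_eq_abs, abs_le]
    constructor <;> linarith [(hx r).1, (hx r).2, (hy r).1, (hy r).2, hLU r]
  refine (Finset.sum_le_sum h1).trans ?_
  rw [Finset.sum_const, Finset.card_univ, Fintype.card_fin, nsmul_eq_mul, mul_pow]
  have h2 : (d : ℝ) ≤ (d : ℝ) ^ 2 := by exact_mod_cast Nat.le_self_pow two_ne_zero d
  gcongr

theorem cube_eq_box (r : ℝ) (n : Fin d → ℤ) :
    cube r n = box (fun i => (n i : ℝ) - r / 2) fun i => (n i : ℝ) + r / 2 := rfl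

theorem volume_cube_one (n : Fin d → ℤ) : volume (cube 1 n) = 1 := by
  rw [cube_eq_box, volume_box]
  refine Finset.prod_eq_one fun r _ => ?_
  norm_num

theorem measurableSet_cube (r : ℝ) (n : Fin d → ℤ) : MeasurableSet (cube r n) :=
  measurableSet_box _ _

theorem iUnion_cube_one : ⋃ n : Fin d → ℤ, cube 1 n = Set.univ := by
  refine Set.eq_univ_of_forall fun x => Set.mem_iUnion.2 ⟨fun i => ⌊x i + 1 / 2⌋, fun i => ?_⟩
  have h1 := Int.floor_le (x i + 1 / 2)
  have h2 := Int.lt_floor_add_one (x i + 1 / 2)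
  constructor <;> linarith

theorem eq_of_mem_cube_one {n n' : Fin d → ℤ} {x : EuclideanSpace ℝ (Fin d)} (h : x ∈ cube 1 n)
    (h' : x ∈ cube 1 n') : n = n' := by
  funext i
  have h1 : (n i : ℝ) < n' i + 1 := by linarith [(h i).1, (h' i).2]
  have h2 : (n' i : ℝ) < n i + 1 := by linarith [(h' i).1, (h i).2]
  have h3 : n i < n' i + 1 := by exact_mod_cast h1
  have h4 : n' i < n i + 1 := by exact_mod_cast h2
  omega

theorem pairwise_disjoint_cube_one :
    Pairwise (Function.onFun Disjoint fun n : Fin d → ℤ => cube 1 n) := fun _ _ hne =>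
  Set.disjoint_left.2 fun _ h h' => hne (eq_of_mem_cube_one h h')

theorem lintegral_eq_tsum_cube (f : EuclideanSpace ℝ (Fin d) → ℝ≥0∞) :
    ∫⁻ x, f x = ∑' n : Fin d → ℤ, ∫⁻ x in cube 1 n, f x := by
  rw [← setLIntegral_univ, ← iUnion_cube_one,
    lintegral_iUnion (fun n => measurableSet_cube 1 n) pairwise_disjoint_cube_one]

/-- The subcube with index `i` of the unit cube centred at `n`, when that cube is divided into
`m ^ d` equal cubes. -/
def cell (n : Fin d → ℤ) (m : ℕ) (i : Fin d → Fin m) : Set (EuclideanSpace ℝ (Fin d)) :=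
  box (fun r => (n r : ℝ) - 1 / 2 + (i r : ℕ) / m) fun r => (n r : ℝ) - 1 / 2 + ((i r : ℕ) + 1) / m

theorem cell_subset_cube (n : Fin d → ℤ) (m : ℕ) (i : Fin d → Fin m) :
    cell n m i ⊆ cube 1 n := by
  intro x hx r
  have hm : (0 : ℝ) < m := by exact_mod_cast (i r).pos
  have h1 : (0 : ℝ) ≤ (i r : ℕ) / m := by positivity
  have h2 : (((i r : ℕ) : ℝ) + 1) / m ≤ 1 := by
    rw [div_le_one hm]
    exact_mod_cast (i r).isLt
  have := hx r
  constructor <;> linarith [(hx r).1, (hx r).2]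

theorem eq_of_mem_cell {n : Fin d → ℤ} {m : ℕ} {i j : Fin d → Fin m}
    {x : EuclideanSpace ℝ (Fin d)} (hi : x ∈ cell n m i) (hj : x ∈ cell n m j) : i = j := by
  funext r
  have hm : (0 : ℝ) < m := by exact_mod_cast (i r).pos
  have h1 : ((i r : ℕ) : ℝ) / m < ((j r : ℕ) + 1) / m := by linarith [(hi r).1, (hj r).2]
  have h2 : ((j r : ℕ) : ℝ) / m < ((i r : ℕ) + 1) / m := by linarith [(hj r).1, (hi r).2]
  rw [div_lt_div_iff_of_pos_right hm] at h1 h2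
  have h3 : (i r : ℕ) < j r + 1 := by exact_mod_cast h1
  have h4 : (j r : ℕ) < i r + 1 := by exact_mod_cast h2
  exact Fin.ext (by omega)

theorem exists_mem_cell {n : Fin d → ℤ} {m : ℕ} (hm : 0 < m) {x : EuclideanSpace ℝ (Fin d)}
    (hx : x ∈ cube 1 n) : ∃ i, x ∈ cell n m i := by
  have hm' : (0 : ℝ) < m := by exact_mod_cast hm
  have h0 : ∀ r, 0 ≤ (x r - n r + 1 / 2) * m := fun r =>
    mul_nonneg (by linarith [(hx r).1]) hm'.le
  have hlt : ∀ r, ⌊(x r - n r + 1 / 2) * m⌋₊ < m := fun r => by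
    rw [Nat.floor_lt (h0 r)]
    have : x r - n r + 1 / 2 < 1 := by linarith [(hx r).2]
    nlinarith
  refine ⟨fun r => ⟨_, hlt r⟩, fun r => ?_⟩
  have h1 := Nat.floor_le (h0 r)
  have h2 := Nat.lt_floor_add_one ((x r - n r + 1 / 2) * m)
  rw [← div_le_iff₀ hm'] at h1
  rw [← lt_div_iff₀ hm'] at h2
  constructor <;> dsimp only <;> linarith

theorem volume_cell_ne_zero (n : Fin d → ℤ) {m : ℕ} (hm : 0 < m) (i : Fin d → Fin m) :
    volume (cell n m i) ≠ 0 := by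
  have hm' : (0 : ℝ) < m := by exact_mod_cast hm
  rw [cell, volume_box, Finset.prod_ne_zero_iff]
  intro r _
  rw [ne_eq, ENNReal.ofReal_eq_zero, not_le, add_sub_add_left_eq_sub, ← sub_div,
    add_sub_cancel_left]
  positivity

/-- The side length of the cells used for parameter `m`; the value `m = 0`, for which there are no
cells at all, counts as mesh size one. -/
def meshSize (m : ℕ) : ℝ := ((max m 1 : ℕ) : ℝ)⁻¹

theorem meshSize_pos (m : ℕ) : 0 < meshSize m := by
  unfold meshSize
  have : 0 < max m 1 := by omega
  positivity

theorem meshSize_le_one (m : ℕ) : meshSize m ≤ 1 := by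
  unfold meshSize
  exact inv_le_one_of_one_le₀ (by exact_mod_cast le_max_right m 1)

/-- The basis functions of the space of piecewise polynomials on the cells of a unit cube. -/
def cellMonomial {ϰ : ℕ} (n : Fin d → ℤ) (m : ℕ) (i : Fin d → Fin m) (β : Fin d → Fin ϰ)
    (x : EuclideanSpace ℝ (Fin d)) : ℂ :=
  (cell n m i).indicator (fun x => ∏ r, (x r : ℂ) ^ (β r : ℕ)) x

/-- Piecewise polynomial approximation on a unit cube, at mesh size `meshSize m`. -/
theorem exists_piecewise_approx (hd : 1 ≤ d) (N : ℕ) {α : ℝ} {ϰ : ℕ} (hα : α ≤ ϰ)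
    (hϰ : 1 ≤ ϰ) :
    ∃ C : ℝ, 0 ≤ C ∧ ∀ (m : ℕ) (n : Fin d → ℤ) {B : ℝ}, 0 ≤ B →
      ∀ {z : Fin N → EuclideanSpace ℝ (Fin d)} {f : EuclideanSpace ℝ (Fin d) → ℂ},
        ContDiffOn ℝ ϰ f (Set.range z)ᶜ →
        (∀ m : ℕ, m ≤ ϰ → ∀ i : Fin m → Fin d, ∀ x ∈ cube 1 n, x ∉ Set.range z →
          ‖partialDeriv i f x‖ ≤ B * (1 + ∑ k, (min 1 ‖x - z k‖) ^ (α - (m : ℝ)))) →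
        (d = 1 → 0 < α → ∃ g : EuclideanSpace ℝ (Fin d) → ℂ,
          ContDiff ℝ (⌈α⌉₊ - 1 : ℕ) g ∧ Set.EqOn f g (Set.range z)ᶜ) →
        ∃ c : (Fin d → Fin m) → (Fin d → Fin ϰ) → ℂ, ∀ᵐ x, x ∈ cube 1 n →
          ‖f x - ∑ i, ∑ β, c i β * cellMonomial n m i β x‖ ≤
            C * (B * (meshSize m ^ ϰ + ∑ k, meshSize m ^ α *
              errorProfile α ϰ (‖x - z k‖ / meshSize m))) := by
  obtain ⟨C, hC, H⟩ := exists_polynomial_approx hd N hα hϰ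
  refine ⟨C + (1 + N + (2 : ℝ) ^ (ϰ - α)), by positivity, ?_⟩
  intro m n B hB0 z f hf hB hg
  have hE : ∀ x, 0 ≤ B * (meshSize m ^ ϰ + ∑ k, meshSize m ^ α *
      errorProfile α ϰ (‖x - z k‖ / meshSize m)) := fun x =>
    mul_nonneg hB0 (add_nonneg (pow_nonneg (meshSize_pos m).le _)
      (Finset.sum_nonneg fun k _ => mul_nonneg (Real.rpow_nonneg (meshSize_pos m).le _)
        (errorProfile_nonneg (div_nonneg (norm_nonneg _) (meshSize_pos m).le))))
  rcases Nat.eq_zero_or_pos m with rfl | hm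
  · have hempty : IsEmpty (Fin d → Fin 0) := ⟨fun i => (i ⟨0, hd⟩).elim0⟩
    refine ⟨fun i => hempty.elim i, ?_⟩
    filter_upwards [measure_eq_zero_iff_ae_notMem.1 (volume_range_fin hd z)] with x hxX hx
    rw [Finset.univ_eq_empty, Finset.sum_empty, sub_zero]
    have h0 := hB 0 (Nat.zero_le _) (fun i => i.elim0) x hx hxX
    rw [norm_partialDeriv_zero, Nat.cast_zero, sub_zero] at h0
    have h1 := norm_le_errorProfile hα hB0 hxX h0
    have hms : meshSize 0 = 1 := by simp [meshSize]
    have h2 := hE x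
    rw [hms] at h2 ⊢
    simp only [one_pow, Real.one_rpow, one_mul, div_one] at h2 ⊢
    refine h1.trans (mul_le_mul_of_nonneg_right ?_ h2)
    linarith
  · have hms : meshSize m = (m : ℝ)⁻¹ := by rw [meshSize, max_eq_left hm]
    have hm' : (0 : ℝ) < m := by exact_mod_cast hm
    have hcell : ∀ i : Fin d → Fin m, ∃ c : (Fin d → Fin ϰ) → ℂ, ∀ᵐ x, x ∈ cell n m i →
        ‖f x - ∑ β, c β * ∏ r, (x r : ℂ) ^ (β r : ℕ)‖ ≤
            C * (B * (meshSize m ^ ϰ + ∑ k, meshSize m ^ α *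
              errorProfile α ϰ (‖x - z k‖ / meshSize m))) := by
      intro i
      obtain ⟨P, ⟨c, hc⟩, hP⟩ := H (meshSize_pos m) (meshSize_le_one m) hB0
        (z := z) (f := f) (Q := cell n m i) (convex_box _ _)
        (fun x hx y hy => norm_sub_le_of_mem_box (meshSize_pos m).le (fun r => by
          rw [hms, add_sub_add_left_eq_sub, ← sub_div, add_sub_cancel_left, one_div]) hx hy)
        (volume_cell_ne_zero n hm i) hf
        (fun k hk j x hx hxX => hB k hk j x (cell_subset_cube n m i hx) hxX) hg
      refine ⟨c, ?_⟩
      simpa only [hc] using hP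
    choose c hc using hcell
    refine ⟨c, ?_⟩
    filter_upwards [ae_all_iff.2 hc] with x hx hxn
    obtain ⟨i, hi⟩ := exists_mem_cell hm hxn
    have hsum : ∑ j, ∑ β, c j β * cellMonomial n m j β x =
        ∑ β, c i β * ∏ r, (x r : ℂ) ^ (β r : ℕ) := by
      rw [Finset.sum_eq_single i]
      · simp only [cellMonomial, Set.indicator_of_mem hi]
      · intro j _ hj
        have : x ∉ cell n m j := fun h => hj (eq_of_mem_cell h hi)
        simp only [cellMonomial, Set.indicator_of_notMem this, mul_zero, Finset.sum_const_zero]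
      · simp
    rw [hsum]
    refine (hx i hi).trans (mul_le_mul_of_nonneg_right ?_ (hE x))
    have : (0 : ℝ) ≤ 1 + N + (2 : ℝ) ^ (ϰ - α) := by positivity
    linarith

end Cells

/-! ### Square integrals of the local error -/

section SquareIntegrals

variable {d N : ℕ}

theorem exists_lintegral_error_sq_le (hd : 1 ≤ d) (N : ℕ) {α : ℝ} {ϰ : ℕ} (hα : -(d : ℝ) / 2 < α)
    (hϰ : α + d / 2 < ϰ) :
    ∃ C : ℝ≥0∞, C ≠ ∞ ∧ ∀ (n : Fin d → ℤ) (z : Fin N → EuclideanSpace ℝ (Fin d)) {h : ℝ},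
      0 < h → h ≤ 1 →
      ∫⁻ x in cube 1 n, ENNReal.ofReal
          (h ^ ϰ + ∑ k, h ^ α * errorProfile α ϰ (‖x - z k‖ / h)) ^ 2 ≤
        C * ENNReal.ofReal (h ^ (2 * α + d)) := by
  set Φ := ∫⁻ x : EuclideanSpace ℝ (Fin d), ENNReal.ofReal (errorProfile α ϰ ‖x‖) ^ 2 with hΦ
  have hΦfin : Φ < ∞ := lintegral_errorProfile_sq_lt_top hd hα hϰ
  refine ⟨2 + N * (ENNReal.ofReal (2 * N) * Φ), by finiteness, ?_⟩
  intro n z h hh hh1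
  have hφ : ∀ x k, 0 ≤ errorProfile α ϰ (‖x - z k‖ / h) := fun x k =>
    errorProfile_nonneg (by positivity)
  have hmeas : Measurable fun r => ENNReal.ofReal (errorProfile α ϰ r) ^ 2 :=
    (measurable_errorProfile α ϰ).ennreal_ofReal.pow_const 2
  have hpt : ∀ x, ENNReal.ofReal (h ^ ϰ + ∑ k, h ^ α * errorProfile α ϰ (‖x - z k‖ / h)) ^ 2 ≤
      ENNReal.ofReal (2 * (h ^ ϰ) ^ 2) + ∑ k, ENNReal.ofReal (2 * N * (h ^ α) ^ 2) *
        ENNReal.ofReal (errorProfile α ϰ (‖x - z k‖ / h)) ^ 2 := by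
    intro x
    have h1 : (h ^ ϰ + ∑ k, h ^ α * errorProfile α ϰ (‖x - z k‖ / h)) ^ 2 ≤
        2 * (h ^ ϰ) ^ 2 + ∑ k, 2 * N * (h ^ α) ^ 2 * errorProfile α ϰ (‖x - z k‖ / h) ^ 2 := by
      have h2 := sq_sum_le_card_mul_sum_sq (s := Finset.univ)
        (f := fun k => h ^ α * errorProfile α ϰ (‖x - z k‖ / h))
      rw [Finset.card_univ, Fintype.card_fin] at h2
      have h3 := add_sq_le (a := h ^ ϰ) (b := ∑ k, h ^ α * errorProfile α ϰ (‖x - z k‖ / h))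
      have h4 : ∑ k, 2 * N * (h ^ α) ^ 2 * errorProfile α ϰ (‖x - z k‖ / h) ^ 2 =
          2 * (N * ∑ k, (h ^ α * errorProfile α ϰ (‖x - z k‖ / h)) ^ 2) := by
        rw [Finset.mul_sum, Finset.mul_sum]
        exact Finset.sum_congr rfl fun k _ => by ring
      rw [h4]
      linarith
    have h0 : 0 ≤ h ^ ϰ + ∑ k, h ^ α * errorProfile α ϰ (‖x - z k‖ / h) :=
      add_nonneg (by positivity)
        (Finset.sum_nonneg fun k _ => mul_nonneg (by positivity) (hφ x k))
    rw [← ENNReal.ofReal_pow h0]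
    refine (ENNReal.ofReal_le_ofReal h1).trans (le_of_eq ?_)
    rw [ENNReal.ofReal_add (by positivity) (Finset.sum_nonneg fun k _ => by positivity),
      ENNReal.ofReal_sum_of_nonneg fun k _ => by positivity]
    congr 1
    refine Finset.sum_congr rfl fun k _ => ?_
    rw [ENNReal.ofReal_mul (by positivity), ENNReal.ofReal_pow (hφ x k)]
  have hpow : ENNReal.ofReal (2 * (h ^ ϰ) ^ 2) ≤ 2 * ENNReal.ofReal (h ^ (2 * α + d)) := by
    have h1 : (h ^ ϰ) ^ 2 ≤ h ^ (2 * α + d) := by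
      rw [← pow_mul, ← Real.rpow_natCast]
      refine Real.rpow_le_rpow_of_exponent_ge hh hh1 ?_
      push_cast
      linarith
    refine (ENNReal.ofReal_le_ofReal (mul_le_mul_of_nonneg_left h1 zero_le_two)).trans ?_
    rw [ENNReal.ofReal_mul zero_le_two, ENNReal.ofReal_ofNat]
  have hterm : ∀ k, ∫⁻ x in cube 1 n, ENNReal.ofReal (2 * N * (h ^ α) ^ 2) *
        ENNReal.ofReal (errorProfile α ϰ (‖x - z k‖ / h)) ^ 2 ≤
      ENNReal.ofReal (2 * N) * Φ * ENNReal.ofReal (h ^ (2 * α + d)) := by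
    intro k
    refine (setLIntegral_le_lintegral _ _).trans ?_
    rw [lintegral_const_mul' _ _ ENNReal.ofReal_ne_top,
      lintegral_norm_sub_div (fun r => ENNReal.ofReal (errorProfile α ϰ r) ^ 2) hmeas (z k) hh,
      ← hΦ, ← mul_assoc, ← ENNReal.ofReal_mul (by positivity)]
    have h1 : 2 * N * (h ^ α) ^ 2 * h ^ d = 2 * N * h ^ (2 * α + d) := by
      rw [← Real.rpow_mul_natCast hh.le, mul_assoc, ← Real.rpow_natCast h d, ← Real.rpow_add hh]
      congr 3
      push_cast
      ring
    rw [h1, ENNReal.ofReal_mul (by positivity)]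
    exact le_of_eq (by ring)
  calc ∫⁻ x in cube 1 n, ENNReal.ofReal
          (h ^ ϰ + ∑ k, h ^ α * errorProfile α ϰ (‖x - z k‖ / h)) ^ 2
      ≤ ∫⁻ x in cube 1 n, (ENNReal.ofReal (2 * (h ^ ϰ) ^ 2) +
          ∑ k, ENNReal.ofReal (2 * N * (h ^ α) ^ 2) *
            ENNReal.ofReal (errorProfile α ϰ (‖x - z k‖ / h)) ^ 2) := lintegral_mono hpt
    _ = ENNReal.ofReal (2 * (h ^ ϰ) ^ 2) +
          ∑ k, ∫⁻ x in cube 1 n, ENNReal.ofReal (2 * N * (h ^ α) ^ 2) *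
            ENNReal.ofReal (errorProfile α ϰ (‖x - z k‖ / h)) ^ 2 := by
        rw [lintegral_add_left measurable_const, lintegral_const, Measure.restrict_apply_univ,
          volume_cube_one, mul_one, lintegral_finsetSum]
        intro k _
        exact (hmeas.comp (by fun_prop : Measurable fun x : EuclideanSpace ℝ (Fin d) =>
          ‖x - z k‖ / h)).const_mul _
    _ ≤ 2 * ENNReal.ofReal (h ^ (2 * α + d)) + ∑ _k : Fin N,
          ENNReal.ofReal (2 * N) * Φ * ENNReal.ofReal (h ^ (2 * α + d)) :=
        add_le_add hpow (Finset.sum_le_sum fun k _ => hterm k)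
    _ = _ := by
        rw [Finset.sum_const, Finset.card_univ, Fintype.card_fin, nsmul_eq_mul]
        ring

/-- A pointwise bound with a factor `A₀` holds with `A₀` replaced by its essential supremum,
because the derivatives are continuous off the singular points. -/
theorem norm_partialDeriv_le_essSup {α : ℝ} {ϰ : ℕ} {z : Fin N → EuclideanSpace ℝ (Fin d)}
    {f : EuclideanSpace ℝ (Fin d) → ℂ} {A₀ : EuclideanSpace ℝ (Fin d) → ℝ}
    (hf : ContDiffOn ℝ ϰ f (Set.range z)ᶜ)
    (hB : ∀ m : ℕ, m ≤ ϰ → ∀ i : Fin m → Fin d, ∀ x ∉ Set.range z,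
      ‖partialDeriv i f x‖ ≤ A₀ x * (1 + ∑ k, (min 1 ‖x - z k‖) ^ (α - (m : ℝ))))
    {n : Fin d → ℤ} (hfin : eLpNorm A₀ ∞ (volume.restrict (cube (2 * Real.pi) n)) ≠ ∞)
    {m : ℕ} (hm : m ≤ ϰ) (i : Fin m → Fin d) {x : EuclideanSpace ℝ (Fin d)} (hx : x ∈ cube 1 n)
    (hxX : x ∉ Set.range z) :
    ‖partialDeriv i f x‖ ≤ (eLpNorm A₀ ∞ (volume.restrict (cube (2 * Real.pi) n))).toReal *
      (1 + ∑ k, (min 1 ‖x - z k‖) ^ (α - (m : ℝ))) := by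
  set b := eLpNorm A₀ ∞ (volume.restrict (cube (2 * Real.pi) n)) with hb
  have hopen : IsOpen (Set.range z)ᶜ := (isClosed_range_fin z).isOpen_compl
  have hcube : cube (2 * Real.pi) n ∈ nhds x := by
    have hpi := Real.pi_gt_three
    have hU : IsOpen {y : EuclideanSpace ℝ (Fin d) | ∀ r, (n r : ℝ) - Real.pi < y r ∧
        y r < n r + Real.pi} := by
      simp only [Set.ofPred_forall]
      refine isOpen_iInter_of_finite fun r => ?_
      have hc : Continuous fun y : EuclideanSpace ℝ (Fin d) => y r := by fun_prop
      exact (isOpen_lt continuous_const hc).inter (isOpen_lt hc continuous_const)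
    refine Filter.mem_of_superset (hU.mem_nhds (x := x) fun r => ?_) fun y hy r => ?_
    · constructor <;> linarith [(hx r).1, (hx r).2]
    · constructor <;> linarith [(hy r).1, (hy r).2]
  have hae : ∀ᵐ y, y ∈ cube (2 * Real.pi) n → A₀ y ≤ b.toReal := by
    rw [← ae_restrict_iff' (measurableSet_cube _ _)]
    filter_upwards [ae_le_eLpNormEssSup (f := A₀)
      (μ := volume.restrict (cube (2 * Real.pi) n))] with y hy
    rw [← eLpNorm_exponent_top, ← hb] at hy
    refine (le_abs_self _).trans ?_
    rw [← Real.norm_eq_abs, ← toReal_enorm]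
    exact ENNReal.toReal_mono hfin hy
  have hL : ContinuousAt (fun y => ‖partialDeriv i f y‖) x := by
    have h1 := ((hf.contDiffAt (hopen.mem_nhds hxX)).continuousAt_iteratedFDeriv (k := m)
      (by exact_mod_cast hm))
    exact ((ContinuousMultilinearMap.apply ℝ (fun _ : Fin m => EuclideanSpace ℝ (Fin d)) ℂ
      fun r => EuclideanSpace.single (i r) (1 : ℝ)).continuous.continuousAt.comp h1).norm
  have hR : ContinuousAt (fun y => b.toReal *
      (1 + ∑ k, (min 1 ‖y - z k‖) ^ (α - (m : ℝ)))) x := by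
    refine continuousAt_const.mul (continuousAt_const.add
      (tendsto_finsetSum _ fun k _ => ContinuousAt.rpow_const (by fun_prop) (Or.inl ?_)))
    exact (lt_min one_pos (sub_pos_of_notMem_range hxX k)).ne'
  refine le_of_tendsto_of_tendsto_of_frequently hL hR ?_
  intro hnot
  have hmem := Filter.inter_mem (Filter.inter_mem hnot hcube) (hopen.mem_nhds hxX)
  refine (Measure.measure_pos_of_mem_nhds volume hmem).ne' ?_
  refine measure_mono_null ?_ (ae_iff.1 hae)
  rintro y ⟨⟨h1, h2⟩, h3⟩ hcon
  refine h1 ((hB m hm i y h3).trans (mul_le_mul_of_nonneg_right (hcon h2) ?_))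
  exact add_nonneg zero_le_one (Finset.sum_nonneg fun k _ =>
    Real.rpow_nonneg (le_min zero_le_one (norm_nonneg _)) _)

/-- Weighted `L²` error of piecewise polynomial approximation on a unit cube. -/
theorem exists_lintegral_sub_cellMonomial_le (hd : 1 ≤ d) (N : ℕ) {α : ℝ} {ϰ : ℕ}
    (hα : -(d : ℝ) / 2 < α) (hϰα : α + d / 2 < ϰ) (hϰ : 1 ≤ ϰ) :
    ∃ C : ℝ≥0∞, C ≠ ∞ ∧ ∀ (m : ℕ) (n : Fin d → ℤ) {z : Fin N → EuclideanSpace ℝ (Fin d)}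
      {f : EuclideanSpace ℝ (Fin d) → ℂ} {A₀ : EuclideanSpace ℝ (Fin d) → ℝ}
      (a : EuclideanSpace ℝ (Fin d) → ℂ),
      ContDiffOn ℝ ϰ f (Set.range z)ᶜ →
      (∀ m : ℕ, m ≤ ϰ → ∀ i : Fin m → Fin d, ∀ x ∉ Set.range z,
        ‖partialDeriv i f x‖ ≤ A₀ x * (1 + ∑ k, (min 1 ‖x - z k‖) ^ (α - (m : ℝ)))) →
      eLpNorm A₀ ∞ (volume.restrict (cube (2 * Real.pi) n)) ≠ ∞ →
      (d = 1 → 0 < α → ∃ g : EuclideanSpace ℝ (Fin d) → ℂ,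
        ContDiff ℝ (⌈α⌉₊ - 1 : ℕ) g ∧ Set.EqOn f g (Set.range z)ᶜ) →
      ∃ c : (Fin d → Fin m) → (Fin d → Fin ϰ) → ℂ,
        ∫⁻ x in cube 1 n, ‖f x * a x -
            ∑ i, ∑ β, c i β * (cellMonomial n m i β x * a x)‖ₑ ^ 2 ≤
          C * ENNReal.ofReal (meshSize m ^ (2 * α + d)) *
            (eLpNorm a ∞ (volume.restrict (cube 1 n)) ^ 2 *
              eLpNorm A₀ ∞ (volume.restrict (cube (2 * Real.pi) n)) ^ 2) := by
  have hd0 : (0 : ℝ) ≤ d := Nat.cast_nonneg d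
  obtain ⟨C₁, hC₁, H₁⟩ := exists_piecewise_approx hd N (by linarith : α ≤ ϰ) hϰ
  obtain ⟨C₂, hC₂, H₂⟩ := exists_lintegral_error_sq_le hd N hα hϰα
  refine ⟨ENNReal.ofReal C₁ ^ 2 * C₂, by finiteness, ?_⟩
  intro m n z f A₀ a hf hB hfin hg
  set b := eLpNorm A₀ ∞ (volume.restrict (cube (2 * Real.pi) n)) with hb
  obtain ⟨c, hc⟩ := H₁ m n ENNReal.toReal_nonneg hf
    (fun k hk i x hx hxX => norm_partialDeriv_le_essSup hf hB hfin hk i hx hxX) hg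
  refine ⟨c, ?_⟩
  set e := eLpNorm a ∞ (volume.restrict (cube 1 n)) with he
  let R : EuclideanSpace ℝ (Fin d) → ℝ := fun x => meshSize m ^ ϰ + ∑ k, meshSize m ^ α *
    errorProfile α ϰ (‖x - z k‖ / meshSize m)
  have hRmeas : Measurable R := by
    have := measurable_errorProfile α ϰ
    fun_prop
  have hpt : ∀ᵐ x ∂volume.restrict (cube 1 n), ‖f x * a x -
      ∑ i, ∑ β, c i β * (cellMonomial n m i β x * a x)‖ₑ ^ 2 ≤
      (ENNReal.ofReal C₁ * b * e) ^ 2 * ENNReal.ofReal (R x) ^ 2 := by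
    filter_upwards [(ae_restrict_iff' (measurableSet_cube 1 n)).2 hc,
      ae_le_eLpNormEssSup (f := a) (μ := volume.restrict (cube 1 n))] with x hx hax
    rw [← eLpNorm_exponent_top, ← he] at hax
    have h1 : f x * a x - ∑ i, ∑ β, c i β * (cellMonomial n m i β x * a x) =
        (f x - ∑ i, ∑ β, c i β * cellMonomial n m i β x) * a x := by
      simp only [sub_mul, Finset.sum_mul, mul_assoc]
    rw [h1, enorm_mul, ← mul_pow]
    refine pow_le_pow_left' ?_ 2
    have h2 : ‖f x - ∑ i, ∑ β, c i β * cellMonomial n m i β x‖ₑ ≤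
        ENNReal.ofReal C₁ * (b * ENNReal.ofReal (R x)) := by
      rw [← ofReal_norm]
      refine (ENNReal.ofReal_le_ofReal hx).trans (le_of_eq ?_)
      rw [ENNReal.ofReal_mul hC₁, ENNReal.ofReal_mul ENNReal.toReal_nonneg,
        ENNReal.ofReal_toReal hfin]
    calc ‖f x - ∑ i, ∑ β, c i β * cellMonomial n m i β x‖ₑ * ‖a x‖ₑ
        ≤ ENNReal.ofReal C₁ * (b * ENNReal.ofReal (R x)) * e := by gcongr
      _ = _ := by ring
  refine (lintegral_mono_ae hpt).trans ?_
  rw [lintegral_const_mul _ (hRmeas.ennreal_ofReal.pow_const 2)]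
  refine (mul_le_mul_right (H₂ n z (meshSize_pos m) (meshSize_le_one m)) _).trans
    (le_of_eq ?_)
  ring

end SquareIntegrals

/-! ### Choice of the meshes -/

section MeshSelection

/-- Distribution of a total budget `κ` of cells over the unit cubes: the cube with weight `W n` gets
about `κ (W n) ^ q / ∑ (W n') ^ q` cells. -/
theorem exists_mesh {I : Type*} {d : ℕ} (hd : 1 ≤ d) {q θ : ℝ} (hq : 0 < q) (hθ : 0 < θ)
    (hθq : θ / d = 2 / q - 1) {W : I → ℝ} (hW : ∀ n, 0 ≤ W n) (hsum : Summable fun n => W n ^ q)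
    {κ : ℝ} (hκ : 0 < κ) :
    ∃ m : I → ℕ, (∃ F : Finset I, ∀ n ∉ F, m n = 0) ∧
      (∀ F : Finset I, ∑ n ∈ F, (m n : ℝ) ^ d ≤ κ) ∧
      ∑' n, ENNReal.ofReal (W n ^ 2 * meshSize (m n) ^ θ) ≤
        ENNReal.ofReal (2 ^ θ * κ ^ (1 - 2 / q) * (∑' n, W n ^ q) ^ (2 / q)) := by
  have hd0 : (0 : ℝ) < d := by exact_mod_cast hd
  set S := ∑' n, W n ^ q with hS
  have hWq : ∀ n, 0 ≤ W n ^ q := fun n => Real.rpow_nonneg (hW n) q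
  have hS0 : 0 ≤ S := tsum_nonneg hWq
  -- if `S = 0`, then division by zero makes every `r n` vanish and no cells are used
  let r : I → ℝ := fun n => κ * W n ^ q / S
  have hr0 : ∀ n, 0 ≤ r n := fun n => div_nonneg (mul_nonneg hκ.le (hWq n)) hS0
  let m : I → ℕ := fun n => ⌊r n ^ (1 / (d : ℝ))⌋₊
  have hrsum : Summable r := (hsum.mul_left κ).div_const S
  have hmr : ∀ n, (m n : ℝ) ^ d ≤ r n := by
    intro n
    have h1 : (m n : ℝ) ≤ r n ^ (1 / (d : ℝ)) := Nat.floor_le (Real.rpow_nonneg (hr0 n) _)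
    refine (pow_le_pow_left₀ (Nat.cast_nonneg _) h1 d).trans (le_of_eq ?_)
    rw [← Real.rpow_mul_natCast (hr0 n), one_div_mul_cancel hd0.ne', Real.rpow_one]
  refine ⟨m, ?_, ?_, ?_⟩
  · have h1 : ∀ᶠ n in Filter.cofinite, r n < 1 :=
      hrsum.tendsto_cofinite_zero.eventually_lt_const one_pos
    have h2 : {n | ¬ r n < 1}.Finite := h1
    refine ⟨h2.toFinset, fun n hn => ?_⟩
    rw [Set.Finite.mem_toFinset, Set.mem_ofPred_eq, not_not] at hn
    by_contra hm
    have h3 : (1 : ℝ) ≤ (m n : ℝ) ^ d :=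
      one_le_pow₀ (by exact_mod_cast Nat.one_le_iff_ne_zero.2 hm)
    linarith [hmr n]
  · intro F
    calc ∑ n ∈ F, (m n : ℝ) ^ d ≤ ∑ n ∈ F, r n := Finset.sum_le_sum fun n _ => hmr n
      _ ≤ ∑' n, r n := hrsum.sum_le_tsum F fun n _ => hr0 n
      _ = κ * S / S := by rw [tsum_div_const, tsum_mul_left]
      _ ≤ κ := div_le_of_le_mul₀ hS0 hκ.le le_rfl
  · set c : ℝ := 2 ^ θ * κ ^ (1 - 2 / q) * S ^ (2 / q - 1) with hc
    have hc0 : 0 ≤ c := by positivity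
    have hterm : ∀ n, W n ^ 2 * meshSize (m n) ^ θ ≤ c * W n ^ q := by
      intro n
      rcases (hW n).eq_or_lt with h0 | h0
      · rw [← h0]
        have : (0 : ℝ) ≤ c * 0 ^ q := by positivity
        simpa using this
      have hWq0 : 0 < W n ^ q := Real.rpow_pos_of_pos h0 q
      have hSpos : 0 < S := hWq0.trans_le (hsum.le_tsum n fun k _ => hWq k)
      have hrpos : 0 < r n := div_pos (mul_pos hκ hWq0) hSpos
      set y := r n ^ (1 / (d : ℝ)) with hy
      have hypos : 0 < y := Real.rpow_pos_of_pos hrpos _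
      have hmesh : meshSize (m n) ≤ 2 / y := by
        have h1 : y < (m n : ℝ) + 1 := Nat.lt_floor_add_one y
        have h2 : (m n : ℝ) + 1 ≤ 2 * (max (m n) 1 : ℕ) := by
          have : m n + 1 ≤ 2 * max (m n) 1 := by omega
          exact_mod_cast this
        have h3 : (0 : ℝ) < (max (m n) 1 : ℕ) := by
          have : 0 < max (m n) 1 := by omega
          exact_mod_cast this
        rw [meshSize, inv_le_comm₀ h3 (by positivity), inv_div]
        linarith
      have h1 : meshSize (m n) ^ θ ≤ 2 ^ θ * r n ^ (1 - 2 / q) := by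
        refine (Real.rpow_le_rpow (meshSize_pos _).le hmesh hθ.le).trans (le_of_eq ?_)
        rw [Real.div_rpow zero_le_two hypos.le, hy, ← Real.rpow_mul hrpos.le, div_eq_mul_inv,
          ← Real.rpow_neg hrpos.le]
        congr 2
        have : 1 / (d : ℝ) * θ = θ / d := by ring
        rw [this, hθq]
        ring
      have h2 : W n ^ 2 * r n ^ (1 - 2 / q) = κ ^ (1 - 2 / q) * S ^ (2 / q - 1) * W n ^ q := by
        have e1 : r n ^ (1 - 2 / q) = κ ^ (1 - 2 / q) * W n ^ (q - 2) * S ^ (2 / q - 1) := by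
          rw [Real.div_rpow (by positivity) hS0, Real.mul_rpow hκ.le hWq0.le,
            ← Real.rpow_mul h0.le, div_eq_mul_inv, ← Real.rpow_neg hS0]
          congr 2
          · congr 1
            field_simp
          · ring
        have e2 : W n ^ 2 * W n ^ (q - 2) = W n ^ q := by
          rw [← Real.rpow_natCast, ← Real.rpow_add h0]
          congr 1
          push_cast
          ring
        rw [e1, ← e2]
        ring
      calc W n ^ 2 * meshSize (m n) ^ θ ≤ W n ^ 2 * (2 ^ θ * r n ^ (1 - 2 / q)) := by gcongr
        _ = 2 ^ θ * (W n ^ 2 * r n ^ (1 - 2 / q)) := by ring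
        _ = c * W n ^ q := by rw [h2, hc]; ring
    have hcS : c * S = 2 ^ θ * κ ^ (1 - 2 / q) * S ^ (2 / q) := by
      rcases hS0.eq_or_lt with h0 | h0
      · rw [← h0, Real.zero_rpow (by positivity), mul_zero, mul_zero]
      · have : S ^ (2 / q) = S ^ (2 / q - 1) * S := by
          conv_rhs => rw [← Real.rpow_one S, ← Real.rpow_mul hS0, one_mul]
          rw [← Real.rpow_add h0, sub_add_cancel]
        rw [this, hc]
        ring
    rw [← hcS, hS, ← tsum_mul_left,
      ENNReal.ofReal_tsum_of_nonneg (fun n => mul_nonneg hc0 (hWq n)) (hsum.mul_left c)]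
    exact ENNReal.tsum_le_tsum fun n => ENNReal.ofReal_le_ofReal (hterm n)

end MeshSelection

/-! ### Approximation of the kernel -/

section KernelApproximation

variable {l d N : ℕ}

theorem memLp_cellMonomial_mul {a : EuclideanSpace ℝ (Fin d) → ℂ} (ha : MemLinftyLoc a) {ϰ : ℕ}
    (n : Fin d → ℤ) (m : ℕ) (i : Fin d → Fin m) (β : Fin d → Fin ϰ) :
    MemLp (fun x => cellMonomial n m i β x * a x) 2 := by
  have hmeas : MeasurableSet (cell n m i) := measurableSet_box _ _
  have hbdd : Bornology.IsBounded (cell n m i) := by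
    have hm : ∀ r, (((i r : ℕ) : ℝ) + 1) / m - (i r : ℕ) / m ≤ 1 := fun r => by
      have hm' : (1 : ℝ) ≤ m := by exact_mod_cast (i r).pos
      rw [← sub_div, add_sub_cancel_left]
      exact div_le_one_of_le₀ hm' (by positivity)
    refine Metric.isBounded_iff.2 ⟨d * 1, fun x hx y hy => ?_⟩
    rw [dist_eq_norm]
    exact norm_sub_le_of_mem_box zero_le_one
      (fun r => by rw [add_sub_add_left_eq_sub]; exact hm r) hx hy
  have hK : IsCompact (closure (cell n m i)) := hbdd.isCompact_closure
  have hind : (fun x => cellMonomial n m i β x * a x) =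
      (cell n m i).indicator fun x => (∏ r, (x r : ℂ) ^ (β r : ℕ)) * a x := by
    ext x
    by_cases hx : x ∈ cell n m i
    · simp [cellMonomial, hx]
    · simp [cellMonomial, hx]
  rw [hind, memLp_indicator_iff_restrict hmeas]
  have hcont : Continuous fun x : EuclideanSpace ℝ (Fin d) => ∏ r, (x r : ℂ) ^ (β r : ℕ) := by
    fun_prop
  obtain ⟨M, hM⟩ := hK.exists_bound_of_continuousOn hcont.continuousOn
  have hmono : MemLp (fun x : EuclideanSpace ℝ (Fin d) => ∏ r, (x r : ℂ) ^ (β r : ℕ)) ∞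
      (volume.restrict (cell n m i)) :=
    memLp_top_of_bound hcont.aestronglyMeasurable M
      ((ae_restrict_iff' hmeas).2 (ae_of_all _ fun x hx => hM x (subset_closure hx)))
  have haK : MemLp a ∞ (volume.restrict (cell n m i)) :=
    (ha _ hK).mono_measure (Measure.restrict_mono_set _ subset_closure)
  have hfin : IsFiniteMeasure (volume.restrict (cell n m i)) :=
    ⟨by rw [Measure.restrict_apply_univ]; exact hbdd.measure_lt_top⟩
  exact (haK.mul (r := ∞) hmono).mono_exponent le_top

theorem aestronglyMeasurable_of_memLinftyLoc {a : EuclideanSpace ℝ (Fin d) → ℂ}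
    (ha : MemLinftyLoc a) : AEStronglyMeasurable a volume := by
  have h : ∀ k : ℕ, AEStronglyMeasurable a
      (volume.restrict (Metric.closedBall (0 : EuclideanSpace ℝ (Fin d)) k)) := fun k =>
    (ha _ (isCompact_closedBall _ _)).1
  have := aestronglyMeasurable_iUnion_iff.2 h
  rwa [Metric.iUnion_closedBall_nat, Measure.restrict_univ] at this

theorem eLpNorm_cube_ne_top {a : EuclideanSpace ℝ (Fin d) → ℂ} (ha : MemLinftyLoc a)
    (n : Fin d → ℤ) : eLpNorm a ∞ (volume.restrict (cube 1 n)) ≠ ∞ := by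
  have hbdd : Bornology.IsBounded (cube 1 n) := by
    refine Metric.isBounded_iff.2 ⟨d * 1, fun x hx y hy => ?_⟩
    rw [dist_eq_norm]
    exact norm_sub_le_of_mem_box zero_le_one (fun r => by norm_num) hx hy
  have h := ha _ hbdd.isCompact_closure
  exact ((eLpNorm_mono_measure a (Measure.restrict_mono_set _ subset_closure)).trans_lt h.2).ne

/-- Index set of the piecewise polynomials that use `m n ^ d` cells in the unit cube at `n`. -/
abbrev CellIndex (d ϰ : ℕ) (F : Finset (Fin d → ℤ)) (m : (Fin d → ℤ) → ℕ) : Type :=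
  Σ n : F, (Fin d → Fin (m n)) × (Fin d → Fin ϰ)

theorem card_cellIndex (d ϰ : ℕ) (F : Finset (Fin d → ℤ)) (m : (Fin d → ℤ) → ℕ) :
    (Fintype.card (CellIndex d ϰ F m) : ℝ) = (ϰ : ℝ) ^ d * ∑ n ∈ F, (m n : ℝ) ^ d := by
  rw [Fintype.card_sigma, ← Finset.sum_coe_sort F, Finset.mul_sum]
  push_cast
  refine Finset.sum_congr rfl fun n _ => ?_
  rw [Fintype.card_prod, Fintype.card_fun, Fintype.card_fun]
  simp only [Fintype.card_fin, Nat.cast_mul, Nat.cast_pow]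
  ring

/-- On the unit cube at `n` only the basis functions attached to `n` are nonzero. -/
theorem sum_cellIndex_eq {ϰ : ℕ} (hd : 1 ≤ d) {F : Finset (Fin d → ℤ)} {m : (Fin d → ℤ) → ℕ}
    (hF : ∀ n ∉ F, m n = 0) (c : ∀ n, (Fin d → Fin (m n)) → (Fin d → Fin ϰ) → ℂ)
    (a : EuclideanSpace ℝ (Fin d) → ℂ) {n : Fin d → ℤ} {x : EuclideanSpace ℝ (Fin d)}
    (hx : x ∈ cube 1 n) :
    ∑ j : CellIndex d ϰ F m, c j.1 j.2.1 j.2.2 * (cellMonomial j.1 (m j.1) j.2.1 j.2.2 x * a x) =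
      ∑ i, ∑ β, c n i β * (cellMonomial n (m n) i β x * a x) := by
  have hzero : ∀ n' : Fin d → ℤ, n' ≠ n →
      ∑ i, ∑ β, c n' i β * (cellMonomial n' (m n') i β x * a x) = 0 := by
    intro n' hne
    refine Finset.sum_eq_zero fun i _ => Finset.sum_eq_zero fun β _ => ?_
    have : x ∉ cell n' (m n') i := fun h =>
      hne (eq_of_mem_cube_one (cell_subset_cube _ _ _ h) hx)
    rw [cellMonomial, Set.indicator_of_notMem this, zero_mul, mul_zero]
  rw [Fintype.sum_sigma]
  simp only [Fintype.sum_prod_type]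
  rw [Finset.sum_coe_sort F fun n' : Fin d → ℤ =>
    ∑ i, ∑ β, c n' i β * (cellMonomial n' (m n') i β x * a x)]
  by_cases hn : n ∈ F
  · exact Finset.sum_eq_single_of_mem n hn fun n' _ hne => hzero n' hne
  · rw [Finset.sum_eq_zero fun n' hn' => hzero n' fun h => hn (h ▸ hn')]
    have : IsEmpty (Fin d → Fin (m n)) := ⟨fun i => by
      have := (i ⟨0, hd⟩).pos
      rw [hF n hn] at this
      exact lt_irrefl 0 this⟩
    rw [Finset.univ_eq_empty, Finset.sum_empty]

/-- The bound for the squared `L²` distance between `T(t, ·) a` and the piecewise polynomials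
(times `a`) with `m n ^ d` cells in the unit cube at `n`; here `θ = 2 α + d`. -/
def meshError (θ : ℝ) (m : (Fin d → ℤ) → ℕ)
    (A : EuclideanSpace ℝ (Fin l) → EuclideanSpace ℝ (Fin d) → ℝ)
    (a : EuclideanSpace ℝ (Fin d) → ℂ) (t : EuclideanSpace ℝ (Fin l)) : ℝ≥0∞ :=
  ∑' n, ENNReal.ofReal (meshSize (m n) ^ θ) *
    (eLpNorm a ∞ (volume.restrict (cube 1 n)) ^ 2 * localSup A n t ^ 2)

theorem lintegral_meshError {θ : ℝ} {m : (Fin d → ℤ) → ℕ}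
    {A : EuclideanSpace ℝ (Fin l) → EuclideanSpace ℝ (Fin d) → ℝ}
    {a : EuclideanSpace ℝ (Fin d) → ℂ} (ha : MemLinftyLoc a)
    (hA : ∀ n : Fin d → ℤ, MemLp (localSup A n) 2 volume) :
    ∫⁻ t, meshError θ m A a t = ∑' n, ENNReal.ofReal ((eLpNorm (localSup A n) 2 volume *
      eLpNorm a ∞ (volume.restrict (cube 1 n))).toReal ^ 2 * meshSize (m n) ^ θ) := by
  have hmeas : ∀ n, AEMeasurable (fun t => localSup A n t ^ 2) volume := fun n =>
    (hA n).1.aemeasurable.pow_const 2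
  unfold meshError
  rw [lintegral_tsum fun n => ((hmeas n).const_mul _).const_mul _]
  refine tsum_congr fun n => ?_
  have hae := eLpNorm_cube_ne_top ha n
  have hAe := (hA n).2.ne
  rw [lintegral_const_mul' _ _ ENNReal.ofReal_ne_top, lintegral_const_mul' _ _ (by finiteness),
    mul_comm (_ ^ 2 : ℝ), ENNReal.ofReal_mul (Real.rpow_nonneg (meshSize_pos _).le _),
    ENNReal.ofReal_pow ENNReal.toReal_nonneg, ENNReal.ofReal_toReal (by finiteness), mul_pow,
    eLpNorm_two_sq]
  simp only [enorm_eq_self]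
  ring

/-- For almost every `t`, the function `T(t, ·) a` is approximated by piecewise polynomials times
`a`. The constant does not depend on the choice of meshes. -/
theorem exists_kernel_approx (l : ℕ) (hd : 1 ≤ d) (N : ℕ) {α : ℝ} (hα : -(d : ℝ) / 2 < α) :
    ∃ C : ℝ≥0∞, C ≠ ∞ ∧
      ∀ {z : Fin N → EuclideanSpace ℝ (Fin l) → EuclideanSpace ℝ (Fin d)}
        {A : EuclideanSpace ℝ (Fin l) → EuclideanSpace ℝ (Fin d) → ℝ}
        {T : EuclideanSpace ℝ (Fin l) → EuclideanSpace ℝ (Fin d) → ℂ}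
        {a : EuclideanSpace ℝ (Fin d) → ℂ},
        IsSingularKernel α z A T →
        (d = 1 → 0 < α → ∀ᵐ t, ∃ g : EuclideanSpace ℝ (Fin d) → ℂ,
          ContDiff ℝ ((⌈α⌉₊ - 1 : ℕ)) g ∧ Set.EqOn (T t) g (Set.range (fun k => z k t))ᶜ) →
        (∀ n : Fin d → ℤ, MemLp (localSup A n) 2 volume) →
        ∀ (m : (Fin d → ℤ) → ℕ) (F : Finset (Fin d → ℤ)), (∀ n ∉ F, m n = 0) →
        ∀ᵐ t, ∃ c : CellIndex d (smoothnessOrder α d) F m → ℂ,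
          ∫⁻ x, ‖T t x * a x - ∑ j, c j * (cellMonomial j.1 (m j.1) j.2.1 j.2.2 x * a x)‖ₑ ^ 2 ≤
            C * meshError (2 * α + d) m A a t := by
  have hd0 : (0 : ℝ) < d := by exact_mod_cast hd
  set ϰ := smoothnessOrder α d with hϰdef
  have hϰα : α + d < ϰ := by
    have h1 : (⌊α⌋ + (d : ℤ) + 1 : ℤ) ≤ (ϰ : ℤ) := Int.self_le_toNat _
    have h2 : ((⌊α⌋ : ℝ) + d + 1) ≤ ϰ := by exact_mod_cast h1
    linarith [Int.lt_floor_add_one α]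
  have hϰ1 : 1 ≤ ϰ := by
    have : (0 : ℝ) < ϰ := by linarith
    exact_mod_cast this
  obtain ⟨C, hC, H⟩ := exists_lintegral_sub_cellMonomial_le hd N hα (by linarith : α + d / 2 < ϰ)
    hϰ1
  refine ⟨C, hC, ?_⟩
  intro z A T a hT hg hA m F hF
  have hfin : ∀ᵐ t, ∀ n : Fin d → ℤ, localSup A n t ≠ ∞ := by
    refine ae_all_iff.2 fun n => ?_
    have h1 : ∫⁻ t, localSup A n t ^ 2 ≠ ∞ := by
      have h2 := eLpNorm_two_sq volume (localSup A n)
      simp only [enorm_eq_self] at h2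
      rw [← h2]
      exact ENNReal.pow_ne_top (hA n).2.ne
    filter_upwards [ae_lt_top' ((hA n).1.aemeasurable.pow_const 2) h1] with t ht
    exact ((ENNReal.pow_lt_top_iff.1 ht).resolve_right two_ne_zero).ne
  have hg' : ∀ᵐ t, d = 1 → 0 < α → ∃ g : EuclideanSpace ℝ (Fin d) → ℂ,
      ContDiff ℝ ((⌈α⌉₊ - 1 : ℕ)) g ∧ Set.EqOn (T t) g (Set.range (fun k => z k t))ᶜ := by
    by_cases h : d = 1 ∧ 0 < α
    · filter_upwards [hg h.1 h.2] with t ht _ _ using ht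
    · exact ae_of_all _ fun t h1 h2 => absurd ⟨h1, h2⟩ h
  filter_upwards [hT.contDiffOn, hT.bound, hfin, hg'] with t ht1 ht2 ht3 ht4
  -- `t` is fixed from here on, so the coefficients may be chosen without regard to measurability
  choose c hc using fun n => H (m n) n a ht1 ht2 (ht3 n) ht4
  refine ⟨fun j => c j.1 j.2.1 j.2.2, ?_⟩
  rw [lintegral_eq_tsum_cube, meshError, ← ENNReal.tsum_mul_left]
  refine ENNReal.tsum_le_tsum fun n => ?_
  rw [← mul_assoc]
  refine le_trans (le_of_eq ?_) (hc n)
  refine setLIntegral_congr_fun (measurableSet_cube 1 n) fun x hx => ?_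
  beta_reduce
  rw [sum_cellIndex_eq hd hF c a hx]

end KernelApproximation

/-! ### The operator and its weak Schatten quasi-norm -/

section Main

variable {l d N : ℕ}

theorem aestronglyMeasurable_kernel {α : ℝ}
    {z : Fin N → EuclideanSpace ℝ (Fin l) → EuclideanSpace ℝ (Fin d)}
    {A : EuclideanSpace ℝ (Fin l) → EuclideanSpace ℝ (Fin d) → ℝ}
    {T : EuclideanSpace ℝ (Fin l) → EuclideanSpace ℝ (Fin d) → ℂ}
    {a : EuclideanSpace ℝ (Fin d) → ℂ} (hT : IsSingularKernel α z A T) (ha : MemLinftyLoc a) :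
    AEStronglyMeasurable (Function.uncurry fun t x => T t x * a x)
      ((volume : Measure (EuclideanSpace ℝ (Fin l))).prod
        (volume : Measure (EuclideanSpace ℝ (Fin d)))) :=
  hT.aestronglyMeasurable.mul (aestronglyMeasurable_of_memLinftyLoc ha).comp_snd

/-- The integral operator exists, and for every `κ > 0` its squared Hilbert–Schmidt norm on the
orthogonal complement of some `O(κ)` vectors is `O(κ ^ (1 - 2 / q))`. -/
theorem exists_operator_approx (l : ℕ) (hd : 1 ≤ d) (N : ℕ) {α q : ℝ} (hα : -(d : ℝ) / 2 < α)
    (hq : 1 / q = 1 + α / d) :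
    ∃ C : ℝ, 0 ≤ C ∧
      ∀ {z : Fin N → EuclideanSpace ℝ (Fin l) → EuclideanSpace ℝ (Fin d)}
        {A : EuclideanSpace ℝ (Fin l) → EuclideanSpace ℝ (Fin d) → ℝ}
        {T : EuclideanSpace ℝ (Fin l) → EuclideanSpace ℝ (Fin d) → ℂ}
        {a : EuclideanSpace ℝ (Fin d) → ℂ},
        IsSingularKernel α z A T →
        (d = 1 → 0 < α → ∀ᵐ t, ∃ g : EuclideanSpace ℝ (Fin d) → ℂ,
          ContDiff ℝ ((⌈α⌉₊ - 1 : ℕ)) g ∧ Set.EqOn (T t) g (Set.range (fun k => z k t))ᶜ) →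
        MemLinftyLoc a →
        (∀ n : Fin d → ℤ, MemLp (localSup A n) 2 volume) →
        latticeBound q A a < ∞ →
        ∃ K : Lp ℂ 2 (volume : Measure (EuclideanSpace ℝ (Fin d))) →L[ℂ]
            Lp ℂ 2 (volume : Measure (EuclideanSpace ℝ (Fin l))),
          IsIntegralOperator (fun t x => T t x * a x) K ∧
          ∀ κ : ℝ, 0 < κ → ∃ (ι : Type) (_ : Fintype ι)
            (b : ι → Lp ℂ 2 (volume : Measure (EuclideanSpace ℝ (Fin d)))),
            (Fintype.card ι : ℝ) ≤ (smoothnessOrder α d : ℝ) ^ d * κ ∧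
            ∀ (p : ℕ) (e : Fin p → Lp ℂ 2 (volume : Measure (EuclideanSpace ℝ (Fin d)))),
              Orthonormal ℂ e → (∀ i k, inner ℂ (b k) (e i) = 0) →
              ∑ i, ‖K (e i)‖ ^ 2 ≤ C * κ ^ (1 - 2 / q) * (latticeBound q A a).toReal ^ 2 := by
  have hd0 : (0 : ℝ) < d := by exact_mod_cast hd
  have hθ : 0 < 2 * α + d := by linarith
  have hq1 : 1 / 2 < 1 / q := by
    rw [hq]
    have : -(1 / 2 : ℝ) < α / d := by
      rw [lt_div_iff₀ hd0]
      linarith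
    linarith
  have hq0 : 0 < q := one_div_pos.1 (by linarith)
  have hθq : (2 * α + d) / d = 2 / q - 1 := by
    have : 2 / q = 2 * (1 / q) := by ring
    rw [this, hq]
    field_simp
    ring
  obtain ⟨C, hC, H⟩ := exists_kernel_approx l hd N hα
  refine ⟨C.toReal * 2 ^ (2 * α + d), by positivity, ?_⟩
  intro z A T a hT hg ha hA hM
  set w : (Fin d → ℤ) → ℝ≥0∞ := fun n => eLpNorm (localSup A n) 2 volume *
    eLpNorm a ∞ (volume.restrict (cube 1 n)) with hw
  have hwfin : ∀ n, w n ≠ ∞ := fun n =>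
    ENNReal.mul_ne_top (hA n).2.ne (eLpNorm_cube_ne_top ha n)
  set W : (Fin d → ℤ) → ℝ := fun n => (w n).toReal with hWdef
  have hW : ∀ n, 0 ≤ W n := fun n => ENNReal.toReal_nonneg
  have hlat : latticeBound q A a = (∑' n, w n ^ q) ^ (1 / q) := by
    rw [latticeBound]
    simp only [hw, ENNReal.mul_rpow_of_nonneg _ _ hq0.le]
  have hSfin : ∑' n, w n ^ q ≠ ∞ := by
    rw [hlat] at hM
    exact (ENNReal.rpow_lt_top_iff_of_pos (by positivity)).1 hM |>.ne
  have hWw : ∀ n, W n ^ q = (w n ^ q).toReal := fun n => ENNReal.toReal_rpow _ _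
  have hsum : Summable fun n => W n ^ q := by
    simp only [hWw]
    exact ENNReal.summable_toReal hSfin
  have hS0 : 0 ≤ ∑' n, W n ^ q := tsum_nonneg fun n => Real.rpow_nonneg (hW n) q
  have hS : (latticeBound q A a).toReal ^ 2 = (∑' n, W n ^ q) ^ (2 / q) := by
    have h1 : ∑' n, W n ^ q = (∑' n, w n ^ q).toReal := by
      simp only [hWw]
      exact (ENNReal.tsum_toReal_eq fun n =>
        ENNReal.rpow_ne_top_of_nonneg hq0.le (hwfin n)).symm
    rw [hlat, ← ENNReal.toReal_rpow, ← h1, ← Real.rpow_mul_natCast hS0]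
    congr 1
    push_cast
    ring
  -- the total error for the mesh with budget `κ`
  have hmesh : ∀ κ : ℝ, 0 < κ → ∃ m : (Fin d → ℤ) → ℕ, (∃ F : Finset (Fin d → ℤ),
      ∀ n ∉ F, m n = 0) ∧ (∀ F : Finset (Fin d → ℤ), ∑ n ∈ F, (m n : ℝ) ^ d ≤ κ) ∧
      ∫⁻ t, C * meshError (2 * α + d) m A a t ≤ ENNReal.ofReal
        (C.toReal * 2 ^ (2 * α + d) * κ ^ (1 - 2 / q) * (latticeBound q A a).toReal ^ 2) := by
    intro κ hκ
    obtain ⟨m, hF, hcard, herr⟩ := exists_mesh hd hq0 hθ hθq hW hsum hκ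
    refine ⟨m, hF, hcard, ?_⟩
    rw [lintegral_const_mul' _ _ hC, lintegral_meshError ha hA, hS]
    refine (mul_le_mul_right herr _).trans (le_of_eq ?_)
    have hassoc : C.toReal * 2 ^ (2 * α + d) * κ ^ (1 - 2 / q) * (∑' n, W n ^ q) ^ (2 / q) =
        C.toReal * (2 ^ (2 * α + d) * κ ^ (1 - 2 / q) * (∑' n, W n ^ q) ^ (2 / q)) := by ring
    rw [hassoc, ENNReal.ofReal_mul ENNReal.toReal_nonneg, ENNReal.ofReal_toReal hC]
  have hsec : ∀ᵐ t, AEStronglyMeasurable (fun x => T t x * a x) volume :=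
    (aestronglyMeasurable_kernel hT ha).prodMk_left
  -- with a budget less than one there are no cells at all, and the error is the full norm
  obtain ⟨ε, hε, hkε⟩ : ∃ ε : EuclideanSpace ℝ (Fin l) → ℝ≥0∞, ∫⁻ t, ε t < ∞ ∧
      ∀ᵐ t, ∫⁻ x, ‖T t x * a x‖ₑ ^ 2 ≤ ε t ∧ ε t < ∞ := by
    obtain ⟨m, _, hcard, herr⟩ := hmesh (1 / 2) (by norm_num)
    have hm0 : ∀ n, m n = 0 := by
      intro n
      by_contra hne
      have h1 : (1 : ℝ) ≤ (m n : ℝ) ^ d :=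
        one_le_pow₀ (by exact_mod_cast Nat.one_le_iff_ne_zero.2 hne)
      have h2 := hcard {n}
      rw [Finset.sum_singleton] at h2
      linarith
    have hlt := herr.trans_lt ENNReal.ofReal_lt_top
    have hmeas : AEMeasurable (fun t => C * meshError (2 * α + d) m A a t) volume := by
      unfold meshError
      exact (AEMeasurable.tsum fun n =>
        (((hA n).1.aemeasurable.pow_const 2).const_mul _).const_mul _).const_mul _
    refine ⟨_, hlt, ?_⟩
    filter_upwards [H (a := a) hT hg hA m ∅ fun n _ => hm0 n, ae_lt_top' hmeas hlt.ne] with t ⟨c, hc⟩ ht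
    refine ⟨?_, ht⟩
    have hempty : IsEmpty (CellIndex d (smoothnessOrder α d) ∅ m) :=
      ⟨fun j => absurd j.1.2 (Finset.notMem_empty _)⟩
    simpa only [Finset.univ_eq_empty, Finset.sum_empty, sub_zero] using hc
  have hkmem : ∀ᵐ t, MemLp (fun x => T t x * a x) 2 := by
    filter_upwards [hsec, hkε] with t h1 h2
    exact memLp_two_of_lintegral_lt_top h1 (h2.1.trans_lt h2.2)
  obtain ⟨K, hK⟩ := exists_isIntegralOperator (aestronglyMeasurable_kernel hT ha) hkmem
    ((lintegral_mono_ae (hkε.mono fun t ht => ht.1)).trans_lt hε).ne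
  refine ⟨K, hK, fun κ hκ => ?_⟩
  obtain ⟨m, ⟨F, hF⟩, hcard, herr⟩ := hmesh κ hκ
  have hφ : ∀ j : CellIndex d (smoothnessOrder α d) F m,
      MemLp (fun x => cellMonomial j.1 (m j.1) j.2.1 j.2.2 x * a x) 2 := fun j =>
    memLp_cellMonomial_mul ha _ _ _ _
  refine ⟨CellIndex d (smoothnessOrder α d) F m, inferInstance,
    fun j => (memLp_conj (hφ j)).toLp _, ?_, ?_⟩
  · rw [card_cellIndex]
    exact mul_le_mul_of_nonneg_left (hcard F) (by positivity)
  · intro p e he horth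
    refine (sum_norm_sq_le_of_orthogonal hK hkmem hφ (herr.trans_lt ENNReal.ofReal_lt_top).ne
      (H hT hg hA m F hF) he horth).trans ?_
    exact ENNReal.toReal_le_of_le_ofReal (by positivity) herr

/-- Conversion of the approximation estimate into a bound for the weak Schatten quasi-norm. -/
theorem memWeakSchatten_of_approx {H G : Type*} [NormedAddCommGroup H] [InnerProductSpace ℂ H]
    [CompleteSpace H] [NormedAddCommGroup G] [InnerProductSpace ℂ G] [CompleteSpace G]
    {K : H →L[ℂ] G} {q R C M : ℝ} (hq : 0 < q) (hq2 : q < 2) (hR : 0 < R) (hC : 0 ≤ C)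
    (hM : 0 ≤ M)
    (h : ∀ κ : ℝ, 0 < κ → ∃ (ι : Type) (_ : Fintype ι) (b : ι → H),
      (Fintype.card ι : ℝ) ≤ R * κ ∧ ∀ (p : ℕ) (e : Fin p → H), Orthonormal ℂ e →
        (∀ i k, inner ℂ (b k) (e i) = 0) →
        ∑ i, ‖K (e i)‖ ^ 2 ≤ C * κ ^ (1 - 2 / q) * M ^ 2) :
    MemWeakSchatten q K ∧ weakSchattenNorm q K ≤
      ENNReal.ofReal (Real.sqrt (2 * C * (2 * R) ^ (2 / q - 1)) * M) := by
  have hbound : weakSchattenNorm q K ≤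
      ENNReal.ofReal (Real.sqrt (2 * C * (2 * R) ^ (2 / q - 1)) * M) := by
    refine iSup₂_le fun j hj => ENNReal.ofReal_le_ofReal ?_
    have hj0 : (0 : ℝ) < j := by exact_mod_cast hj
    -- with this budget the number of basis functions is at most `j / 2`
    obtain ⟨ι, _, b, hcard, hb⟩ := h (j / (2 * R)) (by positivity)
    have hcard' : (Fintype.card ι : ℝ) ≤ j / 2 := by
      refine hcard.trans (le_of_eq ?_)
      field_simp
    have hlt : Fintype.card ι < j := by
      have : (Fintype.card ι : ℝ) < j := by linarith
      exact_mod_cast this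
    have h1 := singularValue_sq_mul_le b hb hlt
    have hs0 : 0 ≤ singularValue K j := Real.sqrt_nonneg _
    have h2 : singularValue K j ^ 2 * (j / 2) ≤ C * (j / (2 * R)) ^ (1 - 2 / q) * M ^ 2 := by
      refine le_trans (mul_le_mul_of_nonneg_left ?_ (sq_nonneg _)) h1
      linarith
    have h3 : (j / (2 * R)) ^ (1 - 2 / q) = (j : ℝ) * (j : ℝ) ^ (-(2 / q)) *
        (2 * R) ^ (2 / q - 1) := by
      rw [Real.div_rpow hj0.le (by positivity), div_eq_mul_inv, ← Real.rpow_neg (by positivity),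
        neg_sub, sub_eq_add_neg, Real.rpow_add hj0, Real.rpow_one]
    have h4 : ((j : ℝ) ^ (1 / q)) ^ 2 * (j : ℝ) ^ (-(2 / q)) = 1 := by
      rw [← Real.rpow_mul_natCast hj0.le, ← Real.rpow_add hj0]
      have : 1 / q * ((2 : ℕ) : ℝ) + -(2 / q) = 0 := by
        push_cast
        ring
      rw [this, Real.rpow_zero]
    refine le_of_sq_le_sq ?_ (by positivity)
    rw [mul_pow, mul_pow, Real.sq_sqrt (by positivity)]
    have h5 : 0 ≤ ((j : ℝ) ^ (1 / q)) ^ 2 := by positivity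
    have h6 := mul_le_mul_of_nonneg_right h2 h5
    rw [h3] at h6
    have h7 : singularValue K j ^ 2 * (j / 2) * ((j : ℝ) ^ (1 / q)) ^ 2 =
        (j / 2) * (singularValue K j ^ 2 * ((j : ℝ) ^ (1 / q)) ^ 2) := by ring
    have h8 : C * ((j : ℝ) * (j : ℝ) ^ (-(2 / q)) * (2 * R) ^ (2 / q - 1)) * M ^ 2 *
        ((j : ℝ) ^ (1 / q)) ^ 2 = (j / 2) * (2 * C * (2 * R) ^ (2 / q - 1) * M ^ 2) *
          (((j : ℝ) ^ (1 / q)) ^ 2 * (j : ℝ) ^ (-(2 / q))) := by ring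
    rw [h7, h8, h4, mul_one] at h6
    exact le_of_mul_le_mul_left h6 (by positivity)
  refine ⟨⟨isCompactOperator_of_small_on_orthogonal fun δ hδ => ?_,
    hbound.trans_lt ENNReal.ofReal_lt_top⟩, hbound⟩
  have hexp : 0 < 2 / q - 1 := by
    rw [sub_pos, one_lt_div hq]
    exact hq2
  have htend : Filter.Tendsto (fun κ : ℝ => C * κ ^ (-(2 / q - 1)) * M ^ 2) Filter.atTop
      (nhds (C * 0 * M ^ 2)) :=
    ((tendsto_rpow_neg_atTop hexp).const_mul C).mul_const _
  rw [mul_zero, zero_mul] at htend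
  obtain ⟨κ, hκ, hκ0⟩ := ((htend.eventually_lt_const (by positivity : (0 : ℝ) < δ ^ 2)).and
    (Filter.eventually_gt_atTop 0)).exists
  obtain ⟨ι, hι, b, _, hb⟩ := h κ hκ0
  refine ⟨ι, hι, b, fun e he heb => ?_⟩
  have h1 := hb 1 (fun _ => e) ⟨fun _ => he, fun i j hij => absurd (Subsingleton.elim i j) hij⟩
    fun _ k => heb k
  rw [neg_sub] at hκ
  simp only [Finset.univ_unique, Finset.sum_singleton] at h1
  exact le_of_sq_le_sq (h1.trans hκ.le) hδ.le

end Main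

end KernelEstimate

end

theorem theorem4p1 (l d N : ℕ) (hl : 1 ≤ l) (hd : 1 ≤ d) (α q : ℝ) (hα : -(d : ℝ) / 2 < α)
    (hq : 1 / q = 1 + α / d) :
    ∃ C : NNReal,
      ∀ (z : Fin N → EuclideanSpace ℝ (Fin l) → EuclideanSpace ℝ (Fin d))
        (A : EuclideanSpace ℝ (Fin l) → EuclideanSpace ℝ (Fin d) → ℝ)
        (T : EuclideanSpace ℝ (Fin l) → EuclideanSpace ℝ (Fin d) → ℂ)
        (a : EuclideanSpace ℝ (Fin d) → ℂ),
        (∀ t x, 0 ≤ A t x) →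
        KernelEstimate.IsSingularKernel α z A T →
        -- only in dimension one, and only for positive exponents
        (d = 1 → 0 < α → ∀ᵐ t, ∃ g : EuclideanSpace ℝ (Fin d) → ℂ,
          ContDiff ℝ ((⌈α⌉₊ - 1 : ℕ)) g ∧ Set.EqOn (T t) g (Set.range (fun k => z k t))ᶜ) →
        KernelEstimate.MemLinftyLoc a →
        (∀ n : Fin d → ℤ, MemLp (KernelEstimate.localSup A n) 2 volume) →
        KernelEstimate.latticeBound q A a < ∞ →
        ∃ K : Lp ℂ 2 (volume : Measure (EuclideanSpace ℝ (Fin d))) →L[ℂ]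
            Lp ℂ 2 (volume : Measure (EuclideanSpace ℝ (Fin l))),
          KernelEstimate.IsIntegralOperator (fun t x => T t x * a x) K ∧
          KernelEstimate.MemWeakSchatten q K ∧
          KernelEstimate.weakSchattenNorm q K ≤ C * KernelEstimate.latticeBound q A a := by
  have hd0 : (0 : ℝ) < d := by exact_mod_cast hd
  have hq1 : 1 / 2 < 1 / q := by
    rw [hq]
    have : -(1 / 2 : ℝ) < α / d := by
      rw [lt_div_iff₀ hd0]
      linarith
    linarith
  have hq0 : 0 < q := one_div_pos.1 (by linarith)
  have hq2 : q < 2 := (one_div_lt_one_div two_pos hq0).1 hq1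
  have hϰ : 0 < KernelEstimate.smoothnessOrder α d := by
    have h1 : -(d : ℝ) < ⌊α⌋ + 1 := by linarith [Int.lt_floor_add_one α]
    have h2 : -(d : ℤ) < ⌊α⌋ + 1 := by exact_mod_cast h1
    rw [KernelEstimate.smoothnessOrder]
    omega
  obtain ⟨C, hC, H⟩ := KernelEstimate.exists_operator_approx l hd N hα hq
  set R : ℝ := (KernelEstimate.smoothnessOrder α d : ℝ) ^ d with hR
  have hR0 : 0 < R := by positivity
  refine ⟨Real.toNNReal (Real.sqrt (2 * C * (2 * R) ^ (2 / q - 1))), ?_⟩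
  intro z A T a _ hT hg ha hA hM
  obtain ⟨K, hK, happ⟩ := H hT hg ha hA hM
  obtain ⟨h1, h2⟩ := KernelEstimate.memWeakSchatten_of_approx hq0 hq2 hR0 hC
    ENNReal.toReal_nonneg happ
  refine ⟨K, hK, h1, h2.trans (le_of_eq ?_)⟩
  rw [ENNReal.ofReal_mul (Real.sqrt_nonneg _), ENNReal.ofReal_toReal hM.ne]
  rfl
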